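/- **Setting.** Let $\widehat p_{\rm rad},\widehat p_{\rm tan}:(0,\infty)^2\to\mathbb R$ be functions of $(\delta,\eta)$ (constitutive functions), and set $\mathcal P_{\rm rad}(x,y)=\widehat p_{\rm rad}(x^3y,x^3)$, $\mathcal P_{\rm tan}(x,y)=\widehat p_{\rm tan}(x^3y,x^3)$, i.e. $x=\eta^{1/3}$, $y=\delta/\eta$. Assume $\mathcal P_{\rm rad},\mathcal P_{\rm tan}\in C^2((0,\infty)^2)$. For $\rho:[0,\infty)\to\mathbb R$ and $\mathcal K>0$ let $m(r)=4\pi\int_0^r\rho(s)s^2\,ds$, $\delta(r)=\rho(r)/\mathcal K$, $\eta(r)=m(r)/(\tfrac{4\pi}{3}\mathcal K r^3)$. A *regular static self-gravitating elastic ball* with reference density $\mathcal K$ and radius $R>0$ is a triple $(\rho,p_{\rm rad},p_{\rm tan})$ of functions on $[0,\infty)$ in $C^0([0,R])\cap C^1((0,R])$ such that $\mathrm{Int}\{r>0:\rho(r)>0\}=(0,R)$; for $r\in(0,R)$ and some potential $\Phi$, $$p_{\rm rad}'=-\tfrac2r(p_{\rm rad}-p_{\rm tan})-\rho\,\Phi',\qquad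 \Phi'=m/r^2;$$ $p_{\rm rad},p_{\rm tan}>0$ on $[0,R)$; $p_{\rm rad}(R)=0$; $p_{\rm rad}(0)=p_{\rm tan}(0)$; $\rho=p_{\rm rad}=p_{\rm tan}=0$ for $r>R$; and $p_{\rm rad}(r)=\widehat p_{\rm rad}(\delta(r),\eta(r))$, $p_{\rm tan}(r)=\widehat p_{\rm tan}(\delta(r),\eta(r))$ for $r\in(0,R]$. **Assumptions.** 1. $\mathcal P_{\rm rad}(1,1)=\mathcal P_{\rm tan}(1,1)=0$, and there are $\mu\ge0$, $\lambda$ with $\lambda+2\mu>0$ such that at $(1,1)$: $\partial_y\mathcal P_{\rm rad}=\lambda+2\mu$, $\partial_x\mathcal P_{\rm rad}=\partial_x\mathcal P_{\rm tan}=3\lambda+2\mu$, $\partial_y\mathcal P_{\rm tan}=\lambda$. 2. $\mathcal P_{\rm rad}(x,1)=\mathcal P_{\rm tan}(x,1)$ for all $x>0$. 3. Put $\Theta(x,y)=\frac{\mathcal P_{\rm tan}(x,y)-\mathcal P_{\rm rad}(x,y)}{1-y}$ for $y\neq1$ and $\Theta(x,1)=\partial_y\mathcal P_{\rm rad}(x,1)-\partial_y\mathcal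 P_{\rm tan}(x,1)$. There are $a,b,c\in\mathbb R$ such that $$\Gamma=(\lambda+2\mu)^{-1}x^ay^b\,\partial_y\mathcal P_{\rm rad},\qquad \Upsilon=(\lambda+2\mu)^{-1}x^ay^{b-1+c}\,(x\partial_x\mathcal P_{\rm rad}+2\Theta)$$ extend continuously to $[0,\infty)^2$ with $\Gamma(0,0)\ne0$ and $\Upsilon(0,0)\neq0$. 4. $a>-4$, $b>0$, $c=0$. 5. There is $X_\flat\in(1,\infty]$ such that $\Gamma(x,1)>0$ and $\Upsilon(x,1)>0$ for $0<x<X_\flat$, and $\Gamma(X_\flat,1)=0$ if $X_\flat<\infty$. 6. $\Gamma,\Upsilon\in C^1([0,\infty)^2)$; $\Gamma>0$ on $[0,X_\flat)\times[0,1)$; and $\Upsilon_0(y)=\Upsilon(0,y)$ satisfies $\Upsilon_0(y)>0$ and $(b\Upsilon_0(y)-y\Upsilon_0'(y))(1-y)+y\Upsilon_0(y)>0$ for $0<y<1$. 7. There is $X_\sharp\in(1,\infty]$ such that $(x,y)\in(0,X_\sharp)\times(0,1)$ and $\mathcal P_{\rm rad}(x,y)\ge0$ imply $\mathcal P_{\rm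 tan}(x,y)>0$; and if $X_\sharp<\infty$ and $\mathcal P_{\rm rad}(X_\sharp,\cdot)$ has a zero in $(0,1)$, then $\mathcal P_{\rm tan}(X_\sharp,\cdot)$ vanishes at some such zero. 8. With $X=\min(X_\flat,X_\sharp)$: $\mathcal P_{\rm rad}(x,1)>0$ for $1<x<X$, and $\mathcal P_{\rm rad}(1,y)<0$ for $0<y<1$. **Theorem.** Under these assumptions let $\Delta_\flat=X_\flat^3$, $\Delta_\sharp=X_\sharp^3$ and $\Delta=\min(\Delta_\flat,\Delta_\sharp)$. Then $\Delta\in(1,\infty]$, and: * $\Delta_\flat$ is the unique element of $(1,\infty]$ such that $\partial_\delta\widehat p_{\rm rad}(\delta,\delta)>0$ for $0<\delta<\Delta_\flat$ and, if $\Delta_\flat<\infty$, $\partial_\delta\widehat p_{\rm rad}(\Delta_\flat,\Delta_\flat)=0$. * $\Delta_\sharp\in(1,\infty]$ has the property that $0<\eta<\Delta_\sharp$, $0<\delta<\eta$ and $\widehat p_{\rm rad}(\delta,\eta)\ge0$ imply $\widehat p_{\rm tan}(\delta,\eta)>0$; and if $\Delta_\sharp<\infty$ and $\widehat p_{\rm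 rad}(\cdot,\Delta_\sharp)$ has a zero in $(0,\Delta_\sharp)$, then $\widehat p_{\rm tan}(\cdot,\Delta_\sharp)$ vanishes at some such zero. If $\Delta_\sharp=\infty$ or $\widehat p_{\rm rad}(\cdot,\Delta_\sharp)$ has a zero in $(0,\Delta_\sharp)$, then $\Delta_\sharp$ is the largest extended real number for which the first of these implications holds, so that $\Delta$ is uniquely determined by $(\widehat p_{\rm rad},\widehat p_{\rm tan})$. * For all $\rho_c,\mathcal K>0$ with $1<\delta_c:=\rho_c/\mathcal K<\Delta$ one has $\widehat p_{\rm rad}(\delta_c,\delta_c)>0$ and $\partial_\delta\widehat p_{\rm rad}(\delta_c,\delta_c)>0$, and there is a unique regular static self-gravitating elastic ball with reference density $\mathcal K$ and central density $\rho(0)=\rho_c$. Its radius $R$ is also unique, and for all $r\in(0,R]$ $$\partial_\delta\widehat p_{\rm rad}(\delta(r),\eta(r))>0,\qquad \rho(r)<\rho_c,\qquad \tfrac{4\pi}{3}\max(\rho(r),\mathcal K)\,r^3<m(r)<\tfrac{4\pi}{3}\rho_c r^3 .$$ -/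

import Mathlib

open Set

noncomputable section

namespace ElasticBall

/-- The open quadrant `(0,∞)²`. -/
def openQuadrant : Set (ℝ × ℝ) := Ioi 0 ×ˢ Ioi 0

/-- The closed quadrant `[0,∞)²`. -/
def closedQuadrant : Set (ℝ × ℝ) := Ici 0 ×ˢ Ici 0

/-- Partial derivative with respect to the first variable. -/
def d1 (f : ℝ → ℝ → ℝ) (s t : ℝ) : ℝ := deriv (fun u => f u t) s

/-- Partial derivative with respect to the second variable. -/
def d2 (f : ℝ → ℝ → ℝ) (s t : ℝ) : ℝ := deriv (fun u => f s u) t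

/-! ### Balls of matter -/

/-- The mass enclosed in the ball of radius `r`: `m(r) = 4π ∫₀ʳ ρ(s) s² ds`. -/
def mass (ρ : ℝ → ℝ) (r : ℝ) : ℝ := 4 * Real.pi * ∫ s in (0 : ℝ)..r, ρ s * s ^ 2

/-- `δ(r) = ρ(r) / 𝒦`. -/
def delta (K : ℝ) (ρ : ℝ → ℝ) (r : ℝ) : ℝ := ρ r / K

/-- `η(r) = m(r) / ((4π/3) 𝒦 r³)`. -/
def eta (K : ℝ) (ρ : ℝ → ℝ) (r : ℝ) : ℝ := mass ρ r / (4 * Real.pi / 3 * K * r ^ 3)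

/-- `f ∈ C⁰([0,R]) ∩ C¹((0,R])`. -/
def RegularProfile (R : ℝ) (f : ℝ → ℝ) : Prop :=
  ContinuousOn f (Icc 0 R) ∧ ContDiffOn ℝ 1 f (Ioc 0 R)

/-- `(ρ, p_rad, p_tan)` is a regular static self-gravitating ball of matter of radius `R`.
Only the values at `r ≥ 0` are meaningful. -/
structure IsRegularBall (R : ℝ) (ρ prad ptan : ℝ → ℝ) : Prop where
  radius_pos : 0 < R
  support : interior {r : ℝ | 0 < r ∧ 0 < ρ r} = Ioo 0 R
  regular_rho : RegularProfile R ρ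
  regular_prad : RegularProfile R prad
  regular_ptan : RegularProfile R ptan
  equilibrium : ∃ Φ : ℝ → ℝ, ∀ r ∈ Ioo 0 R,
    HasDerivAt Φ (mass ρ r / r ^ 2) r ∧
    HasDerivAt prad (-(2 / r) * (prad r - ptan r) - ρ r * deriv Φ r) r
  prad_pos : ∀ r ∈ Ico 0 R, 0 < prad r
  ptan_pos : ∀ r ∈ Ico 0 R, 0 < ptan r
  prad_boundary : prad R = 0
  center : prad 0 = ptan 0
  vacuum : ∀ r, R < r → ρ r = 0 ∧ prad r = 0 ∧ ptan r = 0

/-- A regular ball of matter of radius `R` which is elastic, with reference density `K` and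
constitutive functions `hrad`, `htan` of the variables `(δ, η)`. -/
structure IsRegularElasticBall (hrad htan : ℝ → ℝ → ℝ) (K R : ℝ) (ρ prad ptan : ℝ → ℝ) : Prop
    extends IsRegularBall R ρ prad ptan where
  eos_rad : ∀ r ∈ Ioc 0 R, prad r = hrad (delta K ρ r) (eta K ρ r)
  eos_tan : ∀ r ∈ Ioc 0 R, ptan r = htan (delta K ρ r) (eta K ρ r)

/-! ### Assumptions on the constitutive functions -/

/-- A constitutive function in the variables `x = η^{1/3}`, `y = δ/η`, i.e. `δ = x³y`, `η = x³`. -/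
def inXY (h : ℝ → ℝ → ℝ) (x y : ℝ) : ℝ := h (x ^ 3 * y) (x ^ 3)

/-- `Θ = (P_tan - P_rad) / (1 - y)`, with its continuous extension
`∂_y P_rad - ∂_y P_tan` to `y = 1`. -/
def Theta (Prad Ptan : ℝ → ℝ → ℝ) (x y : ℝ) : ℝ :=
  if y = 1 then d2 Prad x 1 - d2 Ptan x 1 else (Ptan x y - Prad x y) / (1 - y)

/-- The reference configuration is stress-free, and linear elasticity with Lamé coefficients
`lam`, `mu` applies near it. -/
structure LinearElasticAtReference (Prad Ptan : ℝ → ℝ → ℝ) (lam mu : ℝ) : Prop where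
  prad_ref : Prad 1 1 = 0
  ptan_ref : Ptan 1 1 = 0
  dy_prad : d2 Prad 1 1 = lam + 2 * mu
  dx_prad : d1 Prad 1 1 = 3 * lam + 2 * mu
  dy_ptan : d2 Ptan 1 1 = lam
  dx_ptan : d1 Ptan 1 1 = 3 * lam + 2 * mu
  mu_nonneg : 0 ≤ mu
  elliptic : 0 < lam + 2 * mu

/-- The principal pressures agree at the center. -/
def EqualCentralPressures (Prad Ptan : ℝ → ℝ → ℝ) : Prop :=
  ∀ x : ℝ, 0 < x → Prad x 1 = Ptan x 1

/-- Power-law behavior as `x, y → 0⁺`: `Γ` and `Υ` are the continuous extensions to `[0,∞)²` of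
`(λ+2μ)⁻¹ x^a y^b ∂_y P_rad` and `(λ+2μ)⁻¹ x^a y^{b-1+c} (x ∂_x P_rad + 2Θ)`, and they do not
vanish at the origin. -/
structure PowerLawAtZero (Prad Ptan : ℝ → ℝ → ℝ) (lam mu a b c : ℝ) (Γ Υ : ℝ → ℝ → ℝ) :
    Prop where
  gamma_eq : ∀ x y : ℝ, 0 < x → 0 < y →
    Γ x y = (lam + 2 * mu)⁻¹ * x ^ a * y ^ b * d2 Prad x y
  upsilon_eq : ∀ x y : ℝ, 0 < x → 0 < y →
    Υ x y = (lam + 2 * mu)⁻¹ * x ^ a * y ^ (b - 1 + c) *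
      (x * d1 Prad x y + 2 * Theta Prad Ptan x y)
  gamma_cont : ContinuousOn (Function.uncurry Γ) closedQuadrant
  upsilon_cont : ContinuousOn (Function.uncurry Υ) closedQuadrant
  gamma_zero : Γ 0 0 ≠ 0
  upsilon_zero : Υ 0 0 ≠ 0

/-- `X_♭ ∈ (1,∞]` is the first zero of `Γ(·,1)`, and `Υ(·,1)` is positive below `X_♭`. -/
structure CentralHyperbolicity (Γ Υ : ℝ → ℝ → ℝ) (Xflat : EReal) : Prop where
  one_lt : 1 < Xflat
  gamma_pos : ∀ x : ℝ, 0 < x → (x : EReal) < Xflat → 0 < Γ x 1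
  gamma_flat : ∀ x : ℝ, Xflat = (x : EReal) → Γ x 1 = 0
  upsilon_pos : ∀ x : ℝ, 0 < x → (x : EReal) < Xflat → 0 < Υ x 1

/-- `C¹` regularity up to the boundary, positivity of `Γ`, and the inequalities for
`Υ₀(y) = Υ(0,y)`. -/
structure GlobalHyperbolicity (Γ Υ : ℝ → ℝ → ℝ) (b : ℝ) (Xflat : EReal) : Prop where
  gamma_C1 : ContDiffOn ℝ 1 (Function.uncurry Γ) closedQuadrant
  upsilon_C1 : ContDiffOn ℝ 1 (Function.uncurry Υ) closedQuadrant
  gamma_pos : ∀ x y : ℝ, 0 ≤ x → (x : EReal) < Xflat → 0 ≤ y → y < 1 → 0 < Γ x y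
  upsilon_zero_pos : ∀ y : ℝ, 0 < y → y < 1 → 0 < Υ 0 y
  dulac : ∀ y : ℝ, 0 < y → y < 1 →
    0 < (b * Υ 0 y - y * d2 Υ 0 y) * (1 - y) + y * Υ 0 y

/-- `X_♯ ∈ (1,∞]` is such that `P_rad ≥ 0` implies `P_tan > 0` on `(0,X_♯) × (0,1)`, and, if `X_♯`
is finite and `P_rad(X_♯,·)` has a zero in `(0,1)`, then `P_tan(X_♯,·)` vanishes at such a zero. -/
structure TangentialPositivity (Prad Ptan : ℝ → ℝ → ℝ) (Xsharp : EReal) : Prop where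
  one_lt : 1 < Xsharp
  ptan_pos : ∀ x y : ℝ, 0 < x → (x : EReal) < Xsharp → 0 < y → y < 1 →
    0 ≤ Prad x y → 0 < Ptan x y
  boundary : ∀ x : ℝ, Xsharp = (x : EReal) →
    (∃ y ∈ Ioo (0 : ℝ) 1, Prad x y = 0) → ∃ y ∈ Ioo (0 : ℝ) 1, Prad x y = 0 ∧ Ptan x y = 0

/-- Sign of the radial pressure at the center (for `1 < x < X`) and at `x = 1`. -/
structure RadialPressureSigns (Prad : ℝ → ℝ → ℝ) (X : EReal) : Prop where
  center_pos : ∀ x : ℝ, 1 < x → (x : EReal) < X → 0 < Prad x 1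
  neg_at_one : ∀ y : ℝ, 0 < y → y < 1 → Prad 1 y < 0

/-- All the assumptions on the pair `(hrad, htan)` of constitutive functions (in the variables
`(δ, η)`), together with the constants and functions that these assumptions introduce. -/
structure ConstitutiveAssumptions (hrad htan : ℝ → ℝ → ℝ) (lam mu a b c : ℝ)
    (Γ Υ : ℝ → ℝ → ℝ) (Xflat Xsharp : EReal) : Prop where
  rad_C2 : ContDiffOn ℝ 2 (Function.uncurry (inXY hrad)) openQuadrant
  tan_C2 : ContDiffOn ℝ 2 (Function.uncurry (inXY htan)) openQuadrant
  linear : LinearElasticAtReference (inXY hrad) (inXY htan) lam mu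
  equal_center : EqualCentralPressures (inXY hrad) (inXY htan)
  power_law : PowerLawAtZero (inXY hrad) (inXY htan) lam mu a b c Γ Υ
  a_gt : -4 < a
  b_pos : 0 < b
  c_zero : c = 0
  central : CentralHyperbolicity Γ Υ Xflat
  global : GlobalHyperbolicity Γ Υ b Xflat
  tangential : TangentialPositivity (inXY hrad) (inXY htan) Xsharp
  signs : RadialPressureSigns (inXY hrad) (min Xflat Xsharp)

/-! ### The thresholds for the central density, in terms of `(δ, η)` -/

/-- `Δ_♭ ∈ (1,∞]` is the first zero of `δ ↦ ∂_δ p̂_rad(δ,δ)`, which is positive before it. -/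
structure IsDeltaFlat (hrad : ℝ → ℝ → ℝ) (D : EReal) : Prop where
  one_lt : 1 < D
  pos : ∀ δ : ℝ, 0 < δ → (δ : EReal) < D → 0 < d1 hrad δ δ
  zero : ∀ δ : ℝ, D = (δ : EReal) → d1 hrad δ δ = 0

/-- For `0 < η < D` and `0 < δ < η`, `p̂_rad(δ,η) ≥ 0` implies `p̂_tan(δ,η) > 0`. -/
def TanPositiveBelow (hrad htan : ℝ → ℝ → ℝ) (D : EReal) : Prop :=
  ∀ δ η : ℝ, 0 < η → (η : EReal) < D → 0 < δ → δ < η → 0 ≤ hrad δ η → 0 < htan δ η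

/-- The defining property of `Δ_♯ ∈ (1,∞]`. -/
structure IsDeltaSharp (hrad htan : ℝ → ℝ → ℝ) (D : EReal) : Prop where
  one_lt : 1 < D
  pos : TanPositiveBelow hrad htan D
  boundary : ∀ d : ℝ, D = (d : EReal) →
    (∃ δ ∈ Ioo (0 : ℝ) d, hrad δ d = 0) → ∃ δ ∈ Ioo (0 : ℝ) d, hrad δ d = 0 ∧ htan δ d = 0

end ElasticBall

end

/-!
In the variables `ℓ = log x`, `v = 1 - y`, a ball is a solution of
`r ℓ' = -v`, `r v' = -B(ℓ, v) v + r² G(ℓ, v)` with `ℓ(0) = l₀ = log(δ_c) / 3` and `v(0) = 0`, where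
`B` and `G` are regular up to `v = 1`, and `B(l₀, 0) > 0`.

The blow-up `ℓ = l₀ - r²k`, `v = r²w` turns this into a singular equation `r z' = F(r, z)` which a
contraction solves near the center. The solution keeps `0 < v < 1`, because `B` and `G` carry the
factor `1 - v` and `G ≥ 0` pushes `v` upwards at `v = 0`, and a Lyapunov function
`ℓ - θ v + (θ / 2) log r` forces `ℓ` to reach `0` at a finite radius. The radial pressure is
positive at the center and negative where `ℓ = 0`, i.e. `x = 1`, so it has a first zero, which is
the radius of the ball; before it the tangential pressure is positive by the choice of `X_♯`.

Two balls with the same central density solve the same equations. Near the center the singular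
term `-B v / r` is damping, as `B(l₀, 0) > 0`, and away from it the field is Lipschitz: the curves,
hence the balls, agree.
-/

noncomputable section

namespace ElasticBall

open Filter Topology MeasureTheory Metric

open scoped NNReal

theorem nonpos_of_deriv_nonpos_of_pos {f f' : ℝ → ℝ} {a b : ℝ} (hf : ContinuousOn f (Icc a b))
    (hd : ∀ r ∈ Ioo a b, HasDerivAt f (f' r) r) (hs : ∀ r ∈ Ioo a b, 0 < f r → f' r ≤ 0)
    (ha : f a ≤ 0) : ∀ r ∈ Icc a b, f r ≤ 0 := by
  intro r hr
  by_contra! hpos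
  have hfr : ContinuousOn f (Icc a r) := hf.mono (Icc_subset_Icc_right hr.2)
  obtain ⟨s, ⟨hs_mem, hs0⟩, hmax⟩ : ∃ s, IsGreatest (Icc a r ∩ f ⁻¹' Iic 0) s :=
    (isCompact_Icc.of_isClosed_subset (hfr.preimage_isClosed_of_isClosed isClosed_Icc isClosed_Iic)
      inter_subset_left).exists_isGreatest ⟨a, ⟨le_rfl, hr.1⟩, ha⟩
  have hIoo : Ioo s r ⊆ Ioo a b := Ioo_subset_Ioo hs_mem.1 hr.2
  have hpos_after : ∀ t ∈ Ioo s r, 0 < f t := fun t ht => by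
    by_contra! h
    exact ht.1.not_ge (hmax ⟨⟨hs_mem.1.trans ht.1.le, ht.2.le⟩, h⟩)
  have hanti : AntitoneOn f (Icc s r) := by
    refine antitoneOn_of_hasDerivWithinAt_nonpos (f' := f') (convex_Icc s r)
      (hfr.mono (Icc_subset_Icc_left hs_mem.1)) ?_ ?_ <;> rw [interior_Icc] <;> intro t ht
    · exact (hd t (hIoo ht)).hasDerivWithinAt
    · exact hs t (hIoo ht) (hpos_after t ht)
  exact (hpos.trans_le (hanti (left_mem_Icc.2 hs_mem.2) (right_mem_Icc.2 hs_mem.2) hs_mem.2)).not_ge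
    hs0

theorem pos_of_neg_mul_le_deriv {f f' : ℝ → ℝ} {a b N : ℝ} (hN : 0 ≤ N)
    (hf : ContinuousOn f (Icc a b)) (hd : ∀ r ∈ Ioo a b, HasDerivAt f (f' r) r)
    (hs : ∀ r ∈ Ioo a b, -(N * max (f r) 0) ≤ f' r) (ha : 0 < f a) :
    ∀ r ∈ Icc a b, 0 < f r := by
  intro r hr
  suffices f a * Real.exp (-(N * (r - a))) - f r ≤ 0 by
    have : 0 < f a * Real.exp (-(N * (r - a))) := by positivity
    linarith
  refine nonpos_of_deriv_nonpos_of_pos (f := fun r => f a * Real.exp (-(N * (r - a))) - f r)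
    (f' := fun r => f a * (Real.exp (-(N * (r - a))) * (-(N * 1))) - f' r)
    (by fun_prop) (fun t ht => ?_) (fun t ht hpos => ?_) (by simp) r hr
  · exact ((((hasDerivAt_id t).sub_const a).const_mul N).neg.exp.const_mul _).sub (hd t ht)
  · have hmax : max (f t) 0 ≤ f a * Real.exp (-(N * (t - a))) :=
      max_le (by linarith) (by positivity)
    linarith [hs t ht, mul_le_mul_of_nonneg_left hmax hN]

theorem abs_le_mul_sq_of_deriv_damped {f e g : ℝ → ℝ} {h N : ℝ} (hf : ContinuousOn f (Icc 0 h))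
    (hf0 : f 0 = 0) (hd : ∀ r ∈ Ioo 0 h, HasDerivAt f (e r - g r * f r) r)
    (hg : ∀ r ∈ Ioo 0 h, 0 ≤ g r) (he : ∀ r ∈ Ioo 0 h, |e r| ≤ 2 * N * r) :
    ∀ r ∈ Icc 0 h, |f r| ≤ N * r ^ 2 := by
  have hsq : ∀ r : ℝ, HasDerivAt (fun r : ℝ => N * r ^ 2) (N * (2 * r)) r := fun r => by
    simpa using (hasDerivAt_pow 2 r).const_mul N
  have hsq_nonneg : ∀ r ∈ Ioo 0 h, 0 ≤ N * r ^ 2 := fun r hr => by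
    nlinarith [(abs_nonneg _).trans (he r hr), hr.1]
  have upper := nonpos_of_deriv_nonpos_of_pos (f := fun r => f r - N * r ^ 2) (by fun_prop)
    (fun r hr => (hd r hr).sub (hsq r))
    (fun r hr hpos => by
      linarith [(abs_le.1 (he r hr)).2, mul_nonneg (hg r hr)
        (show 0 ≤ f r by linarith [hsq_nonneg r hr])]) (by simp [hf0])
  have lower := nonpos_of_deriv_nonpos_of_pos (f := fun r => -f r - N * r ^ 2) (by fun_prop)
    (fun r hr => (hd r hr).neg.sub (hsq r))
    (fun r hr hpos => by
      linarith [(abs_le.1 (he r hr)).1, mul_nonneg (hg r hr)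
        (show 0 ≤ -f r by linarith [hsq_nonneg r hr])]) (by simp [hf0])
  exact fun r hr => abs_le.2 ⟨by linarith [lower r hr], by linarith [upper r hr]⟩

theorem exists_first_zero {f : ℝ → ℝ} {a b : ℝ} (hab : a ≤ b) (hf : ContinuousOn f (Icc a b))
    (ha : 0 < f a) (hb : f b ≤ 0) : ∃ c ∈ Ioc a b, f c = 0 ∧ ∀ r ∈ Ico a c, 0 < f r := by
  obtain ⟨d, hd, hd0⟩ : (0 : ℝ) ∈ f '' Icc a b := intermediate_value_Icc' hab hf ⟨hb, ha.le⟩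
  obtain ⟨c, ⟨hc, hc0⟩, hmin⟩ : ∃ c, IsLeast (Icc a b ∩ f ⁻¹' {0}) c :=
    (isCompact_Icc.of_isClosed_subset
      (hf.preimage_isClosed_of_isClosed isClosed_Icc isClosed_singleton)
      inter_subset_left).exists_isLeast ⟨d, hd, hd0⟩
  have hc0 : f c = 0 := hc0
  have hac : a < c := hc.1.lt_of_ne (by rintro rfl; exact ha.ne' hc0)
  refine ⟨c, ⟨hac, hc.2⟩, hc0, fun r hr => ?_⟩
  by_contra! h
  obtain ⟨t, ht, ht0⟩ : (0 : ℝ) ∈ f '' Icc a r :=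
    intermediate_value_Icc' hr.1 (hf.mono (Icc_subset_Icc_right (hr.2.le.trans hc.2))) ⟨h, ha.le⟩
  exact (ht.2.trans_lt hr.2).not_ge (hmin ⟨⟨ht.1, ht.2.trans (hr.2.le.trans hc.2)⟩, ht0⟩)

section RadialMean

variable {E : Type*} [NormedAddCommGroup E] [NormedSpace ℝ E]

/-- The weighted mean `∫₀¹ tⁿ g(tr) dt = r⁻⁽ⁿ⁺¹⁾ ∫₀ʳ sⁿ g(s) ds`: the solution of the singular
equation `r u' + (n + 1) u = g` which is continuous at `r = 0`. -/
def radialMean (n : ℕ) (g : ℝ → E) (r : ℝ) : E :=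
  ∫ t in (0 : ℝ)..1, t ^ n • g (t * r)

variable {n : ℕ} {g g₁ g₂ : ℝ → E}

theorem continuous_radialMean (hg : Continuous g) : Continuous (radialMean n g) :=
  intervalIntegral.continuous_parametric_intervalIntegral_of_continuous'
    (f := fun r t => t ^ n • g (t * r)) (by fun_prop) 0 1

theorem radialMean_const [CompleteSpace E] (c : E) (r : ℝ) :
    radialMean n (fun _ => c) r = ((n : ℝ) + 1)⁻¹ • c := by
  simp [radialMean, intervalIntegral.integral_smul_const, integral_pow]

theorem norm_radialMean_sub_le {C h r : ℝ} (hg₁ : Continuous g₁) (hg₂ : Continuous g₂)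
    (hr : r ∈ Icc 0 h) (hC : ∀ s ∈ Icc 0 h, ‖g₁ s - g₂ s‖ ≤ C) :
    ‖radialMean n g₁ r - radialMean n g₂ r‖ ≤ ((n : ℝ) + 1)⁻¹ * C := by
  have hint : ∫ t in (0 : ℝ)..1, t ^ n * C = ((n : ℝ) + 1)⁻¹ * C := by
    simp [intervalIntegral.integral_mul_const, integral_pow]
  rw [← hint, radialMean, radialMean, ← intervalIntegral.integral_sub
    (Continuous.intervalIntegrable (by fun_prop) _ _)
    (Continuous.intervalIntegrable (by fun_prop) _ _)]
  refine intervalIntegral.norm_integral_le_of_norm_le zero_le_one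
    (Eventually.of_forall fun t ht => ?_) (Continuous.intervalIntegrable (by fun_prop) _ _)
  rw [← smul_sub, norm_smul, norm_pow, Real.norm_of_nonneg ht.1.le]
  have hmem : t * r ∈ Icc 0 h :=
    ⟨mul_nonneg ht.1.le hr.1, (mul_le_of_le_one_left hr.1 ht.2).trans hr.2⟩
  exact mul_le_mul_of_nonneg_left (hC _ hmem) (pow_nonneg ht.1.le n)

theorem pow_smul_radialMean (r : ℝ) :
    r ^ (n + 1) • radialMean n g r = ∫ s in (0 : ℝ)..r, s ^ n • g s := by
  have hsubst := intervalIntegral.smul_integral_comp_mul_right (a := 0) (b := 1)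
    (fun s : ℝ => s ^ n • g s) r
  simp only [zero_mul, one_mul, mul_pow, mul_comm _ (r ^ n), mul_smul] at hsubst
  rw [intervalIntegral.integral_smul, smul_smul, ← pow_succ'] at hsubst
  exact hsubst

theorem hasDerivAt_radialMean [CompleteSpace E] (hg : Continuous g) {r : ℝ} (hr : r ≠ 0) :
    HasDerivAt (radialMean n g) (r⁻¹ • (g r - ((n : ℝ) + 1) • radialMean n g r)) r := by
  have hfc : Continuous fun s : ℝ => s ^ n • g s := by fun_prop
  have hint : HasDerivAt (fun r => ∫ s in (0 : ℝ)..r, s ^ n • g s) (r ^ n • g r) r :=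
    intervalIntegral.integral_hasDerivAt_right (hfc.intervalIntegrable _ _)
      (hfc.stronglyMeasurableAtFilter _ _) hfc.continuousAt
  have hinv : HasDerivAt (fun r : ℝ => (r ^ (n + 1))⁻¹)
      (-(((n : ℝ) + 1) * r ^ n) / (r ^ (n + 1)) ^ 2) r := by
    simpa using (hasDerivAt_pow (n + 1) r).fun_inv (pow_ne_zero _ hr)
  have hev : radialMean n g =ᶠ[𝓝 r]
      fun r => (r ^ (n + 1))⁻¹ • ∫ s in (0 : ℝ)..r, s ^ n • g s := by
    filter_upwards [isOpen_ne.mem_nhds hr] with s hs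
    rw [← pow_smul_radialMean, smul_smul, inv_mul_cancel₀ (pow_ne_zero _ hs), one_smul]
  refine ((hinv.fun_smul hint).congr_of_eventuallyEq hev).congr_deriv ?_
  rw [← pow_smul_radialMean]
  match_scalars <;> field_simp <;> ring

theorem radialMean_zero [CompleteSpace E] (g : ℝ → E) :
    radialMean n g 0 = ((n : ℝ) + 1)⁻¹ • g 0 := by
  rw [← radialMean_const (g 0) 0]
  simp [radialMean]

end RadialMean

section SingularEquation

variable {E : Type*} [NormedAddCommGroup E] [NormedSpace ℝ E]

/-- The data of a contraction for the singular equation `r u' + (n + 1) u = H(r, u)` on `[0, h]`,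
with values in the closed ball of radius `δ` around `u₀`. -/
structure ContractsOn (H : ℝ × E → E) (n : ℕ) (h : ℝ) (u₀ : E) (δ : ℝ) (q : ℝ≥0) : Prop where
  h_pos : 0 < h
  δ_nonneg : 0 ≤ δ
  q_lt : (q : ℝ) < n + 1
  cont : ContinuousOn H (Icc 0 h ×ˢ closedBall u₀ δ)
  lipschitz : ∀ r ∈ Icc 0 h, LipschitzOnWith q (fun u => H (r, u)) (closedBall u₀ δ)
  defect : ∀ r ∈ Icc 0 h, ‖H (r, u₀) - ((n : ℝ) + 1) • u₀‖ ≤ (n + 1 - q) * δ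

variable {H : ℝ × E → E} {n : ℕ} {h : ℝ} {u₀ : E} {δ : ℝ} {q : ℝ≥0}

/-- The right-hand side `H(r, φ(r))` along a curve in the ball, extended to be constant outside
`[0, h]`. -/
def extendedField (hH : ContractsOn H n h u₀ δ q) (φ : C(Icc 0 h, closedBall u₀ δ)) : ℝ → E :=
  IccExtend hH.h_pos.le fun r => H (r, φ r)

namespace ContractsOn

theorem continuous_extendedField (hH : ContractsOn H n h u₀ δ q)
    (φ : C(Icc 0 h, closedBall u₀ δ)) : Continuous (extendedField hH φ) :=
  Continuous.Icc_extend' <| hH.cont.comp_continuous (by fun_prop) fun r => ⟨r.2, (φ r).2⟩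

theorem extendedField_of_mem (hH : ContractsOn H n h u₀ δ q) (φ : C(Icc 0 h, closedBall u₀ δ))
    {r : ℝ} (hr : r ∈ Icc 0 h) : extendedField hH φ r = H (r, φ ⟨r, hr⟩) :=
  IccExtend_of_mem _ _ hr

theorem norm_sub_center_le (hH : ContractsOn H n h u₀ δ q) {r : ℝ} (hr : r ∈ Icc 0 h) {u : E}
    (hu : u ∈ closedBall u₀ δ) : ‖H (r, u) - ((n : ℝ) + 1) • u₀‖ ≤ (n + 1) * δ := by
  have hlip : ‖H (r, u) - H (r, u₀)‖ ≤ q * δ := by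
    rw [← dist_eq_norm]
    exact ((hH.lipschitz r hr).dist_le_mul u hu u₀ (mem_closedBall_self hH.δ_nonneg)).trans
      (mul_le_mul_of_nonneg_left (mem_closedBall.1 hu) q.2)
  linarith [norm_sub_le_norm_sub_add_norm_sub (H (r, u)) (H (r, u₀)) (((n : ℝ) + 1) • u₀),
    hH.defect r hr]

theorem eq_of_smul_eq (hH : ContractsOn H n h u₀ δ q) {u v : E} (hu : u ∈ closedBall u₀ δ)
    (hv : v ∈ closedBall u₀ δ) (hu' : ((n : ℝ) + 1) • u = H (0, u))
    (hv' : ((n : ℝ) + 1) • v = H (0, v)) : u = v := by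
  have hn : (0 : ℝ) < n + 1 := by positivity
  have hlip := (hH.lipschitz 0 ⟨le_rfl, hH.h_pos.le⟩).dist_le_mul u hu v hv
  rw [← hu', ← hv', dist_smul₀, Real.norm_of_nonneg hn.le] at hlip
  exact dist_le_zero.1 (by nlinarith [hH.q_lt, dist_nonneg (x := u) (y := v)])

variable [CompleteSpace E]

theorem radialMean_mem (hH : ContractsOn H n h u₀ δ q) (φ : C(Icc 0 h, closedBall u₀ δ)) {r : ℝ}
    (hr : r ∈ Icc 0 h) : radialMean n (extendedField hH φ) r ∈ closedBall u₀ δ := by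
  have hn : (0 : ℝ) < n + 1 := by positivity
  have hmean := norm_radialMean_sub_le (n := n) (hH.continuous_extendedField φ)
    (continuous_const (y := ((n : ℝ) + 1) • u₀)) hr fun s hs =>
      (hH.extendedField_of_mem φ hs).symm ▸ hH.norm_sub_center_le hs (φ _).2
  rwa [radialMean_const, inv_smul_smul₀ hn.ne', inv_mul_cancel_left₀ hn.ne',
    ← mem_closedBall_iff_norm] at hmean

/-- The integral operator whose fixed points solve `r u' + (n + 1) u = H(r, u)`. -/
def picard (hH : ContractsOn H n h u₀ δ q) (φ : C(Icc 0 h, closedBall u₀ δ)) :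
    C(Icc 0 h, closedBall u₀ δ) :=
  ⟨fun r => ⟨radialMean n (extendedField hH φ) r, hH.radialMean_mem φ r.2⟩, by
    have := continuous_radialMean (n := n) (hH.continuous_extendedField φ)
    fun_prop⟩

theorem contractingWith_picard (hH : ContractsOn H n h u₀ δ q) :
    ContractingWith (q / (n + 1)) hH.picard := by
  refine ⟨?_, LipschitzWith.of_dist_le_mul fun φ ψ => ?_⟩
  · rw [div_lt_one (by positivity)]
    exact_mod_cast hH.q_lt
  rw [ContinuousMap.dist_le (by positivity)]
  intro r
  rw [Subtype.dist_eq, dist_eq_norm]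
  refine (norm_radialMean_sub_le (hH.continuous_extendedField φ) (hH.continuous_extendedField ψ)
    r.2 (C := q * dist φ ψ) fun s hs => ?_).trans_eq (by push_cast; ring)
  rw [hH.extendedField_of_mem φ hs, hH.extendedField_of_mem ψ hs, ← dist_eq_norm]
  exact ((hH.lipschitz s hs).dist_le_mul _ (φ _).2 _ (ψ _).2).trans
    (mul_le_mul_of_nonneg_left (ContinuousMap.dist_apply_le_dist (f := φ) (g := ψ) _) q.2)

theorem exists_solution (hH : ContractsOn H n h u₀ δ q) :
    ∃ u : ℝ → E, Continuous u ∧ (∀ r ∈ Icc 0 h, u r ∈ closedBall u₀ δ) ∧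
      ((n : ℝ) + 1) • u 0 = H (0, u 0) ∧
      ∀ r ∈ Ioo 0 h, HasDerivAt u (r⁻¹ • (H (r, u r) - ((n : ℝ) + 1) • u r)) r := by
  have : Nonempty C(Icc 0 h, closedBall u₀ δ) :=
    ⟨.const _ ⟨u₀, mem_closedBall_self hH.δ_nonneg⟩⟩
  have : CompleteSpace (closedBall u₀ δ) := isClosed_closedBall.completeSpace_coe
  obtain ⟨φ, hφ⟩ : ∃ φ, hH.picard φ = φ := ⟨_, hH.contractingWith_picard.fixedPoint_isFixedPt⟩
  have hfix : ∀ r (hr : r ∈ Icc 0 h), radialMean n (extendedField hH φ) r = φ ⟨r, hr⟩ :=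
    fun r hr => congrArg (fun ψ => (ψ ⟨r, hr⟩ : E)) hφ
  have hfield : ∀ r ∈ Icc 0 h, extendedField hH φ r =
      H (r, radialMean n (extendedField hH φ) r) := fun r hr => by
    rw [hfix r hr, hH.extendedField_of_mem φ hr]
  have hcont := hH.continuous_extendedField φ
  refine ⟨radialMean n (extendedField hH φ), continuous_radialMean hcont,
    fun r hr => hH.radialMean_mem φ hr, ?_, fun r hr => ?_⟩
  · rw [← hfield 0 ⟨le_rfl, hH.h_pos.le⟩, radialMean_zero, smul_inv_smul₀ (by positivity)]
  · rw [← hfield r (Ioo_subset_Icc_self hr)]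
    exact hasDerivAt_radialMean hcont hr.1.ne'

end ContractsOn

end SingularEquation

section SingularLinearization

variable {E : Type*} [NormedAddCommGroup E] [NormedSpace ℝ E]

theorem exists_contractsOn {H : ℝ × E → E} {n : ℕ} {u₀ : E} {V : Set (ℝ × E)}
    {H' : ℝ × E →L[ℝ] E} (hV : V ∈ 𝓝 (0, u₀)) (hcont : ContinuousOn H V)
    (hH : HasStrictFDerivAt H H' (0, u₀)) (h0 : H (0, u₀) = ((n : ℝ) + 1) • u₀)
    (hn : ‖H'.comp (.inr ℝ ℝ E)‖ < n + 1) :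
    ∃ h δ q, ContractsOn H n h u₀ δ q := by
  set L := H'.comp (.inr ℝ ℝ E)
  obtain ⟨c, hc0, hc⟩ : ∃ c : ℝ≥0, 0 < c ∧ ‖L‖₊ + c < (n : ℝ) + 1 := by
    obtain ⟨c, hc0, hc⟩ := exists_between (sub_pos.2 hn)
    exact ⟨⟨c, hc0.le⟩, hc0, by
      change ‖L‖ + c < n + 1
      linarith⟩
  obtain ⟨s, hs, happrox⟩ := hH.approximates_deriv_on_nhds (Or.inr hc0)
  obtain ⟨δ, hδ, hball⟩ := nhds_basis_closedBall.mem_iff.1 (inter_mem hV hs)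
  have hbound : 0 < ((n : ℝ) + 1 - (‖L‖₊ + c : ℝ≥0)) * δ :=
    mul_pos (sub_pos.2 (by exact_mod_cast hc)) hδ
  have hslice : ContinuousAt (fun r : ℝ => ‖H (r, u₀) - ((n : ℝ) + 1) • u₀‖) 0 :=
    ((hcont.continuousAt hV).comp (f := fun r : ℝ => (r, u₀)) (by fun_prop)).sub
      continuousAt_const |>.norm
  obtain ⟨h, hh, hdefect⟩ := nhds_basis_closedBall.mem_iff.1
    (hslice.eventually (gt_mem_nhds (by simpa [h0] using hbound)))
  have hmem : ∀ r ∈ Icc 0 (min h δ), ∀ u ∈ closedBall u₀ δ, (r, u) ∈ V ∩ s := fun r hr u hu =>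
    hball (closedBall_prod_same (0 : ℝ) u₀ δ ▸
      ⟨by simpa [abs_of_nonneg hr.1] using hr.2.trans (min_le_right _ _), hu⟩)
  refine ⟨min h δ, δ, ‖L‖₊ + c, lt_min hh hδ, hδ.le, by exact_mod_cast hc,
    hcont.mono fun p hp => (hmem _ hp.1 _ hp.2).1, fun r hr => ?_, fun r hr => ?_⟩
  · refine LipschitzOnWith.of_dist_le_mul fun u hu v hv => ?_
    have happ : ‖H (r, u) - H (r, v) - L (u - v)‖ ≤ c * ‖u - v‖ := by
      simpa [L] using happrox (r, u) (hmem r hr u hu).2 (r, v) (hmem r hr v hv).2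
    rw [dist_eq_norm, dist_eq_norm, NNReal.coe_add, coe_nnnorm, add_mul, ← sub_add_cancel
      (H (r, u) - H (r, v)) (L (u - v)), add_comm]
    exact (norm_add_le _ _).trans (add_le_add (L.le_opNorm _) happ)
  · exact (hdefect (by simpa [abs_of_nonneg hr.1] using hr.2.trans (min_le_left _ _))).le

theorem exists_solution_singular [CompleteSpace E] {F : ℝ × E → E} {u₀ : E} {A : E →L[ℝ] E}
    (n : ℕ) (hF : ContDiffAt ℝ 1 F (0, u₀)) (hF0 : F (0, u₀) = 0)
    (hA : HasFDerivAt (fun u => F (0, u)) A u₀)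
    (hn : ‖A + ((n : ℝ) + 1) • .id ℝ E‖ < n + 1) :
    ∃ h > 0, ∃ u : ℝ → E, Continuous u ∧ u 0 = u₀ ∧
      ∀ r ∈ Ioo 0 h, HasDerivAt u (r⁻¹ • F (r, u r)) r := by
  set H : ℝ × E → E := fun p => F p + ((n : ℝ) + 1) • p.2 with hH
  have hHC1 : ContDiffAt ℝ 1 H (0, u₀) := hF.add (by fun_prop)
  have hH0 : H (0, u₀) = ((n : ℝ) + 1) • u₀ := by simp [hH, hF0]
  have hslice : (fderiv ℝ H (0, u₀)).comp (.inr ℝ ℝ E) = A + ((n : ℝ) + 1) • .id ℝ E :=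
    ((hHC1.differentiableAt one_ne_zero).hasFDerivAt.comp u₀
      (hasFDerivAt_prodMk_right (0 : ℝ) u₀)).unique (hA.add ((hasFDerivAt_id u₀).const_smul _))
  obtain ⟨h, δ, q, hC⟩ := exists_contractsOn (hHC1.eventually (by simp))
    (fun p (hp : ContDiffAt ℝ 1 H p) => hp.continuousAt.continuousWithinAt)
    (hHC1.hasStrictFDerivAt one_ne_zero) hH0 (hslice ▸ hn)
  obtain ⟨u, hu, hmem, hfix, hd⟩ := hC.exists_solution
  have h0 : (0 : ℝ) ∈ Icc 0 h := ⟨le_rfl, hC.h_pos.le⟩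
  refine ⟨h, hC.h_pos, u, hu, ?_, fun r hr => ?_⟩
  · exact hC.eq_of_smul_eq (hmem 0 h0) (mem_closedBall_self hC.δ_nonneg) hfix hH0.symm
  · simpa [hH] using hd r hr

end SingularLinearization

section StructureEquations

theorem hasDerivAt_fst_comp {u : ℝ → ℝ × ℝ} {u' : ℝ × ℝ} {r : ℝ} (h : HasDerivAt u u' r) :
    HasDerivAt (fun s => (u s).1) u'.1 r :=
  (ContinuousLinearMap.fst ℝ ℝ ℝ).hasFDerivAt.comp_hasDerivAt r h

theorem hasDerivAt_snd_comp {u : ℝ → ℝ × ℝ} {u' : ℝ × ℝ} {r : ℝ} (h : HasDerivAt u u' r) :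
    HasDerivAt (fun s => (u s).2) u'.2 r :=
  (ContinuousLinearMap.snd ℝ ℝ ℝ).hasFDerivAt.comp_hasDerivAt r h

/-- The vector field of the structure equations `r ℓ' = -v`, `r v' = -B(ℓ, v) v + r² G(ℓ, v)`
of a ball, in terms of `p = (ℓ, v)` with `ℓ = log x` and `v = 1 - y`. -/
def structureField (B G : ℝ × ℝ → ℝ) (r : ℝ) (p : ℝ × ℝ) : ℝ × ℝ :=
  (-p.2 / r, (-B p * p.2 + r ^ 2 * G p) / r)

/-- The curve `u` satisfies the structure equations at `r`. -/
def SolvesAt (B G : ℝ × ℝ → ℝ) (u : ℝ → ℝ × ℝ) (r : ℝ) : Prop :=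
  HasDerivAt u (structureField B G r (u r)) r

variable {B G : ℝ × ℝ → ℝ} {u : ℝ → ℝ × ℝ} {r : ℝ}

theorem SolvesAt.hasDerivAt_fst (h : SolvesAt B G u r) :
    HasDerivAt (fun s => (u s).1) (-(u r).2 / r) r :=
  hasDerivAt_fst_comp h

theorem SolvesAt.hasDerivAt_snd (h : SolvesAt B G u r) :
    HasDerivAt (fun s => (u s).2) ((-B (u r) * (u r).2 + r ^ 2 * G (u r)) / r) r :=
  hasDerivAt_snd_comp h

/-- The substitution `ℓ = l₀ - r²k`, `v = r²w`, which desingularizes the structure equations at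
the center. -/
def blowUp (l₀ r : ℝ) (p : ℝ × ℝ) : ℝ × ℝ :=
  (l₀ - r ^ 2 * p.1, r ^ 2 * p.2)

/-- The structure equations in terms of `(k, w)`: `r (k, w)' = blowUpField B G l₀ (r, (k, w))`. -/
def blowUpField (B G : ℝ × ℝ → ℝ) (l₀ : ℝ) (p : ℝ × ℝ × ℝ) : ℝ × ℝ :=
  (-2 * p.2.1 + p.2.2,
    -(2 + B (blowUp l₀ p.1 p.2)) * p.2.2 + G (blowUp l₀ p.1 p.2))

theorem solvesAt_blowUp {l₀ : ℝ} {z : ℝ → ℝ × ℝ} (hr : r ≠ 0)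
    (hz : HasDerivAt z (r⁻¹ • blowUpField B G l₀ (r, z r)) r) :
    SolvesAt B G (fun s => blowUp l₀ s (z s)) r := by
  have hsq : HasDerivAt (fun s : ℝ => s ^ 2) (2 * r) r := by simpa using hasDerivAt_pow 2 r
  have hk : HasDerivAt (fun s => (z s).1) _ r := hasDerivAt_fst_comp hz
  have hw : HasDerivAt (fun s => (z s).2) _ r := hasDerivAt_snd_comp hz
  refine (((hsq.mul hk).const_sub l₀).prodMk (hsq.mul hw)).congr_deriv (Prod.ext ?_ ?_) <;>
  · simp only [structureField, blowUp, blowUpField, Prod.smul_fst, Prod.smul_snd, smul_eq_mul]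
    field_simp
    ring

theorem contDiffAt_blowUpField {l₀ : ℝ} (hB : ContDiffAt ℝ 1 B (l₀, 0))
    (hG : ContDiffAt ℝ 1 G (l₀, 0)) (p : ℝ × ℝ) :
    ContDiffAt ℝ 1 (blowUpField B G l₀) (0, p) := by
  have hP : ContDiff ℝ 1 fun q : ℝ × ℝ × ℝ => blowUp l₀ q.1 q.2 := by
    unfold blowUp
    fun_prop
  have hP0 : blowUp l₀ 0 p = (l₀, 0) := by simp [blowUp]
  have hB' : ContDiffAt ℝ 1 (fun q : ℝ × ℝ × ℝ => B (blowUp l₀ q.1 q.2)) (0, p) :=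
    ContDiffAt.comp (g := B) (0, p) (by simpa only [hP0] using hB) hP.contDiffAt
  have hG' : ContDiffAt ℝ 1 (fun q : ℝ × ℝ × ℝ => G (blowUp l₀ q.1 q.2)) (0, p) :=
    ContDiffAt.comp (g := G) (0, p) (by simpa only [hP0] using hG) hP.contDiffAt
  have hk : ContDiffAt ℝ 1 (fun q : ℝ × ℝ × ℝ => -2 * q.2.1 + q.2.2) (0, p) := by fun_prop
  have hw : ContDiffAt ℝ 1 (fun q : ℝ × ℝ × ℝ => q.2.2) (0, p) := by fun_prop
  exact hk.prodMk (((contDiffAt_const.add hB').neg.mul hw).add hG')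

/-- The linear part of the blown-up equations at the center. -/
def blowUpLinear (β : ℝ) : ℝ × ℝ →L[ℝ] ℝ × ℝ :=
  ((-2 : ℝ) • ContinuousLinearMap.fst ℝ ℝ ℝ + ContinuousLinearMap.snd ℝ ℝ ℝ).prod
    (-(2 + β) • ContinuousLinearMap.snd ℝ ℝ ℝ)

theorem norm_blowUpLinear_add_lt {β : ℝ} {n : ℕ} (hβ : -1 ≤ β) (hn : 1 ≤ n) (hβn : β ≤ 2 * n - 1) :
    ‖blowUpLinear β + ((n : ℝ) + 1) • .id ℝ (ℝ × ℝ)‖ < n + 1 := by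
  have hn' : (1 : ℝ) ≤ n := by exact_mod_cast hn
  refine (ContinuousLinearMap.opNorm_le_bound _ (by positivity) fun p => ?_).trans_lt
    (lt_add_one (n : ℝ))
  have h1 : ‖p.1‖ ≤ ‖p‖ := norm_fst_le p
  have h2 : ‖p.2‖ ≤ ‖p‖ := norm_snd_le p
  have e : (blowUpLinear β + ((n : ℝ) + 1) • .id ℝ (ℝ × ℝ)) p =
      ((n - 1) * p.1 + p.2, (n - 1 - β) * p.2) := by
    ext <;> simp [blowUpLinear] <;> ring
  rw [e]
  refine max_le ?_ ?_
  · calc ‖(n - 1) * p.1 + p.2‖ ≤ (n - 1) * ‖p.1‖ + ‖p.2‖ := by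
          refine (norm_add_le _ _).trans_eq ?_
          rw [norm_mul, Real.norm_of_nonneg (sub_nonneg.2 hn')]
      _ ≤ (n - 1) * ‖p‖ + ‖p‖ := by gcongr
      _ = n * ‖p‖ := by ring
  · rw [norm_mul]
    have : ‖(n : ℝ) - 1 - β‖ ≤ n := abs_le.2 ⟨by linarith, by linarith⟩
    gcongr

theorem exists_solution_center {l₀ : ℝ} (hB : ContDiffAt ℝ 1 B (l₀, 0))
    (hG : ContDiffAt ℝ 1 G (l₀, 0)) (hB0 : 0 ≤ B (l₀, 0)) (hG0 : 0 < G (l₀, 0)) :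
    ∃ h > 0, ∃ u : ℝ → ℝ × ℝ, Continuous u ∧ u 0 = (l₀, 0) ∧
      ∀ r ∈ Ioo 0 h, SolvesAt B G u r ∧ 0 < (u r).2 := by
  set β := B (l₀, 0) with hβ
  set w₀ := G (l₀, 0) / (2 + β) with hw₀
  obtain ⟨n, hn⟩ := exists_nat_ge (β + 1)
  have hn1 : 1 ≤ n := by exact_mod_cast (by linarith : (1 : ℝ) ≤ n)
  have hP0 : ∀ p, blowUp l₀ 0 p = (l₀, 0) := fun p => by simp [blowUp]
  have hlin : HasFDerivAt (fun p => blowUpField B G l₀ (0, p)) (blowUpLinear β) (w₀ / 2, w₀) := by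
    simpa [blowUpField, blowUpLinear, hP0, Function.comp_def, hβ] using
      (blowUpLinear β).hasFDerivAt.add_const (0, G (l₀, 0))
  have hzero : blowUpField B G l₀ (0, (w₀ / 2, w₀)) = 0 := by
    have : 2 + β ≠ 0 := by positivity
    simp only [blowUpField, hP0, ← hβ, hw₀, Prod.mk_eq_zero]
    constructor <;> field_simp <;> ring
  obtain ⟨h, hh, z, hz, hz0, hd⟩ := exists_solution_singular n (contDiffAt_blowUpField hB hG _)
    hzero hlin (norm_blowUpLinear_add_lt (by linarith) hn1 (by linarith))
  have hw_pos : ∀ᶠ r in 𝓝 (0 : ℝ), 0 < (z r).2 :=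
    continuousAt_const.eventually_lt hz.snd.continuousAt (by rw [hz0]; positivity)
  obtain ⟨ε, hε, hpos⟩ := Metric.eventually_nhds_iff.1 hw_pos
  refine ⟨min h ε, lt_min hh hε, fun r => blowUp l₀ r (z r), ?_, hP0 _, fun r hr => ⟨?_, ?_⟩⟩
  · unfold blowUp
    fun_prop
  · exact solvesAt_blowUp hr.1.ne' (hd r ⟨hr.1, hr.2.trans_le (min_le_left _ _)⟩)
  · refine mul_pos (pow_pos hr.1 2) (hpos ?_)
    simpa [abs_of_pos hr.1] using hr.2.trans_le (min_le_right _ _)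

end StructureEquations

section Retraction

variable {E : Type*} [NormedAddCommGroup E] [NormedSpace ℝ E]

theorem exists_lipschitzOnWith_of_contDiffOn {F : Type*} [NormedAddCommGroup F] [NormedSpace ℝ F]
    {f : E → F} {s : Set E} (hf : ContDiffOn ℝ 1 f s) (hs : Convex ℝ s) (hs' : IsCompact s) :
    ∃ K, LipschitzOnWith K f s :=
  LocallyLipschitzOn.exists_lipschitzOnWith_of_compact hs' fun _ hx =>
    (hf _ hx).exists_lipschitzOnWith hs

theorem exists_solution_comp_retraction [CompleteSpace E] {F : ℝ × E → E} {π : E → E} {K : Set E}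
    {a T : ℝ} (haT : a ≤ T) (hF : ContDiffOn ℝ 1 F (Icc a T ×ˢ K)) (hK : IsCompact K)
    (hKc : Convex ℝ K) (hπ : LipschitzWith 1 π) (hπK : ∀ p, π p ∈ K) (p₀ : E) :
    ∃ u : ℝ → E, u a = p₀ ∧ ∀ r ∈ Icc a T, HasDerivWithinAt u (F (r, π (u r))) (Icc a T) r := by
  have hcomp : IsCompact (Icc a T ×ˢ K) := isCompact_Icc.prod hK
  obtain ⟨C, hC⟩ := exists_lipschitzOnWith_of_contDiffOn hF ((convex_Icc a T).prod hKc) hcomp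
  obtain ⟨M, hM⟩ := hcomp.exists_bound_of_continuousOn hF.continuousOn
  have hpl : IsPicardLindelof (fun r p => F (r, π p)) (⟨a, le_rfl, haT⟩ : Icc a T) p₀
      (M.toNNReal * (T - a).toNNReal) 0 M.toNNReal C := by
    refine ⟨fun r hr => LipschitzWith.lipschitzOnWith fun p q => ?_, fun p _ => ?_,
      fun r hr p _ => (hM _ ⟨hr, hπK p⟩).trans (Real.le_coe_toNNReal M), ?_⟩
    · calc edist (F (r, π p)) (F (r, π q)) ≤ C * edist (r, π p) (r, π q) :=
            hC ⟨hr, hπK p⟩ ⟨hr, hπK q⟩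
        _ = C * edist (π p) (π q) := by simp [Prod.edist_eq]
        _ ≤ C * edist p q := by gcongr; simpa using hπ p q
    · exact hF.continuousOn.comp (by fun_prop) fun r hr => ⟨hr, hπK p⟩
    · simp [Real.coe_toNNReal _ (sub_nonneg.2 haT), max_eq_left (sub_nonneg.2 haT)]
  exact hpl.exists_eq_forall_mem_Icc_hasDerivWithinAt₀

end Retraction

section Continuation

/-- The rectangle `0 ≤ ℓ ≤ l₀`, `0 ≤ v ≤ 1` of the phase space. -/
def rect (l₀ : ℝ) : Set (ℝ × ℝ) :=
  Icc 0 l₀ ×ˢ Icc 0 1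

/-- The retraction of the plane onto `rect l₀`. -/
def rectProj (l₀ : ℝ) (p : ℝ × ℝ) : ℝ × ℝ :=
  (max 0 (min l₀ p.1), max 0 (min 1 p.2))

theorem isCompact_rect (l₀ : ℝ) : IsCompact (rect l₀) :=
  isCompact_Icc.prod isCompact_Icc

theorem convex_rect (l₀ : ℝ) : Convex ℝ (rect l₀) :=
  (convex_Icc _ _).prod (convex_Icc _ _)

theorem rectProj_mem {l₀ : ℝ} (hl₀ : 0 ≤ l₀) (p : ℝ × ℝ) : rectProj l₀ p ∈ rect l₀ :=
  ⟨⟨le_max_left _ _, max_le hl₀ (min_le_left _ _)⟩,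
    le_max_left _ _, max_le zero_le_one (min_le_left _ _)⟩

theorem rectProj_of_mem {l₀ : ℝ} {p : ℝ × ℝ} (hp : p ∈ rect l₀) : rectProj l₀ p = p := by
  obtain ⟨⟨h1, h2⟩, h3, h4⟩ := hp
  simp [rectProj, h1, h2, h3, h4]

theorem lipschitzWith_rectProj (l₀ : ℝ) : LipschitzWith 1 (rectProj l₀) := by
  have := ((LipschitzWith.prod_fst.const_min l₀).const_max 0).prodMk
    ((LipschitzWith.prod_snd.const_min 1).const_max 0)
  rw [max_self] at this
  exact this

theorem rectProj_snd_le (l₀ : ℝ) (p : ℝ × ℝ) : (rectProj l₀ p).2 ≤ max p.2 0 :=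
  max_le (le_max_right _ _) ((min_le_right _ _).trans (le_max_left _ _))

theorem one_sub_rectProj_snd_le (l₀ : ℝ) (p : ℝ × ℝ) :
    1 - (rectProj l₀ p).2 ≤ max (1 - p.2) 0 := by
  have : min 1 p.2 ≤ (rectProj l₀ p).2 := le_max_right _ _
  rcases min_cases 1 p.2 with ⟨h, -⟩ | ⟨h, -⟩
  · exact le_max_of_le_right (by linarith)
  · exact le_max_of_le_left (by linarith)

/-- The product of a coefficient with `y = 1 - v`. -/
def timesY (f : ℝ × ℝ → ℝ) (p : ℝ × ℝ) : ℝ :=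
  (1 - p.2) * f p

/-- The hypotheses under which solutions of the structure equations with coefficients
`B = (1 - v) B₁` and `G = (1 - v) G₁` can be continued until `ℓ = 0`. -/
structure ContinuationHyp (B₁ G₁ : ℝ × ℝ → ℝ) (l₀ : ℝ) : Prop where
  B₁_C1 : ContDiffOn ℝ 1 B₁ (rect l₀)
  G_C1 : ContDiffOn ℝ 1 (timesY G₁) (rect l₀)
  G₁_cont : ContinuousOn G₁ (rect l₀)
  G₁_pos : ∀ p ∈ rect l₀, p.2 < 1 → 0 < G₁ p

variable {B₁ G₁ : ℝ × ℝ → ℝ} {l₀ a T : ℝ} {u : ℝ → ℝ × ℝ}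

theorem ContinuationHyp.timesY_nonneg (hyp : ContinuationHyp B₁ G₁ l₀) {p : ℝ × ℝ}
    (hp : p ∈ rect l₀) : 0 ≤ timesY G₁ p := by
  rcases hp.2.2.lt_or_eq with h | h
  · exact mul_nonneg (by linarith) (hyp.G₁_pos p hp h).le
  · simp [timesY, h]

/-- `u` solves on `[a, T]` the structure equations with the vector field frozen outside
`rect l₀`. -/
def SolvesClamped (B₁ G₁ : ℝ × ℝ → ℝ) (l₀ a T : ℝ) (u : ℝ → ℝ × ℝ) : Prop :=
  ∀ r ∈ Icc a T,
    HasDerivWithinAt u (structureField (timesY B₁) (timesY G₁) r (rectProj l₀ (u r))) (Icc a T) r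

theorem ContinuationHyp.exists_solvesClamped (hyp : ContinuationHyp B₁ G₁ l₀) (hl₀ : 0 ≤ l₀)
    (ha : 0 < a) (haT : a ≤ T) (p₀ : ℝ × ℝ) : ∃ u, u a = p₀ ∧ SolvesClamped B₁ G₁ l₀ a T u := by
  refine exists_solution_comp_retraction (K := rect l₀)
    (F := fun q => structureField (timesY B₁) (timesY G₁) q.1 q.2) haT ?_ (isCompact_rect l₀)
    (convex_rect l₀) (lipschitzWith_rectProj l₀) (rectProj_mem hl₀) p₀
  have hmaps : MapsTo Prod.snd (Icc a T ×ˢ rect l₀) (rect l₀) := fun _ h => h.2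
  have hB : ContDiffOn ℝ 1 (timesY B₁) (rect l₀) :=
    (contDiff_const.sub contDiff_snd).contDiffOn.mul hyp.B₁_C1
  have hB' := hB.comp contDiff_snd.contDiffOn hmaps
  have hG' := hyp.G_C1.comp contDiff_snd.contDiffOn hmaps
  have hv : ContDiffOn ℝ 1 (fun q : ℝ × ℝ × ℝ => q.2.2) (Icc a T ×ˢ rect l₀) := by fun_prop
  have hr : ContDiffOn ℝ 1 (fun q : ℝ × ℝ × ℝ => q.1) (Icc a T ×ˢ rect l₀) := by fun_prop
  have hr0 : ∀ q ∈ Icc a T ×ˢ rect l₀, q.1 ≠ 0 := fun q hq => (ha.trans_le hq.1.1).ne'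
  exact (hv.neg.div hr hr0).prodMk (((hB'.neg.mul hv).add ((hr.pow 2).mul hG')).div hr hr0)

namespace SolvesClamped

theorem continuousOn (hu : SolvesClamped B₁ G₁ l₀ a T u) : ContinuousOn u (Icc a T) :=
  fun r hr => (hu r hr).continuousWithinAt

theorem hasDerivAt (hu : SolvesClamped B₁ G₁ l₀ a T u) {r : ℝ} (hr : r ∈ Ioo a T) :
    HasDerivAt u (structureField (timesY B₁) (timesY G₁) r (rectProj l₀ (u r))) r :=
  (hu r (Ioo_subset_Icc_self hr)).hasDerivAt (Icc_mem_nhds hr.1 hr.2)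

theorem snd_pos (hu : SolvesClamped B₁ G₁ l₀ a T u) (hyp : ContinuationHyp B₁ G₁ l₀) (hl₀ : 0 ≤ l₀)
    (ha : 0 < a) (hua : 0 < (u a).2) : ∀ r ∈ Icc a T, 0 < (u r).2 := by
  obtain ⟨N, hN⟩ := (isCompact_rect l₀).exists_bound_of_continuousOn hyp.B₁_C1.continuousOn
  have hN0 : 0 ≤ N := (norm_nonneg _).trans (hN _ (rectProj_mem hl₀ 0))
  refine pos_of_neg_mul_le_deriv (N := N / a) (by positivity) hu.continuousOn.snd
    (fun r hr => hasDerivAt_snd_comp (hu.hasDerivAt hr)) (fun r hr => ?_) hua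
  have hr0 : 0 < r := ha.trans hr.1
  set p := rectProj l₀ (u r)
  have hp : p ∈ rect l₀ := rectProj_mem hl₀ _
  have hB : timesY B₁ p * p.2 ≤ N * max (u r).2 0 := by
    have : timesY B₁ p ≤ N := by
      unfold timesY
      nlinarith [abs_le.1 (hN p hp), hp.2.1, hp.2.2]
    exact mul_le_mul this (rectProj_snd_le _ _) hp.2.1 hN0
  calc -(N / a * max (u r).2 0) = -(N * max (u r).2 0 / a) := by ring
    _ ≤ -(N * max (u r).2 0 / r) := by gcongr; exact hr.1.le
    _ ≤ (-timesY B₁ p * p.2 + r ^ 2 * timesY G₁ p) / r := by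
      rw [← neg_div]
      gcongr
      linarith [mul_nonneg (sq_nonneg r) (hyp.timesY_nonneg hp)]

theorem snd_lt_one (hu : SolvesClamped B₁ G₁ l₀ a T u) (hyp : ContinuationHyp B₁ G₁ l₀)
    (hl₀ : 0 ≤ l₀) (ha : 0 < a) (hua : (u a).2 < 1) : ∀ r ∈ Icc a T, (u r).2 < 1 := by
  obtain ⟨N, hN⟩ := (isCompact_rect l₀).exists_bound_of_continuousOn hyp.B₁_C1.continuousOn
  have hN0 : 0 ≤ N := (norm_nonneg _).trans (hN _ (rectProj_mem hl₀ 0))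
  obtain ⟨C, hC⟩ := (isCompact_rect l₀).exists_bound_of_continuousOn hyp.G₁_cont
  have hC0 : 0 ≤ C := (norm_nonneg _).trans (hC _ (rectProj_mem hl₀ 0))
  suffices ∀ r ∈ Icc a T, 0 < 1 - (u r).2 from fun r hr => sub_pos.1 (this r hr)
  refine pos_of_neg_mul_le_deriv (N := (N + T ^ 2 * C) / a) (by positivity)
    (continuousOn_const.sub hu.continuousOn.snd)
    (fun r hr => (hasDerivAt_snd_comp (hu.hasDerivAt hr)).const_sub 1) (fun r hr => ?_)
    (sub_pos.2 hua)
  have hr0 : 0 < r := ha.trans hr.1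
  set p := rectProj l₀ (u r)
  set m := max (1 - (u r).2) 0
  have hp : p ∈ rect l₀ := rectProj_mem hl₀ _
  have hG : r ^ 2 * G₁ p ≤ T ^ 2 * C :=
    mul_le_mul_of_nonneg (pow_le_pow_left₀ hr0.le hr.2.le 2) ((le_abs_self _).trans (hC p hp))
      (sq_nonneg r) hC0
  have hB : -(B₁ p * p.2) ≤ N := by nlinarith [abs_le.1 (hN p hp), hp.2.1, hp.2.2]
  have hm : (1 - p.2) * (-(B₁ p * p.2) + r ^ 2 * G₁ p) ≤ m * (N + T ^ 2 * C) :=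
    mul_le_mul_of_nonneg (one_sub_rectProj_snd_le l₀ (u r)) (by linarith)
      (by linarith [hp.2.2]) (by positivity)
  rw [neg_le_neg_iff]
  calc (-timesY B₁ p * p.2 + r ^ 2 * timesY G₁ p) / r
      = (1 - p.2) * (-(B₁ p * p.2) + r ^ 2 * G₁ p) / r := by simp only [timesY]; ring
    _ ≤ m * (N + T ^ 2 * C) / r := by gcongr
    _ ≤ m * (N + T ^ 2 * C) / a := by gcongr; exact hr.1.le
    _ = (N + T ^ 2 * C) / a * m := by ring

theorem antitoneOn_fst (hu : SolvesClamped B₁ G₁ l₀ a T u) (hl₀ : 0 ≤ l₀) (ha : 0 < a) :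
    AntitoneOn (fun r => (u r).1) (Icc a T) := by
  refine antitoneOn_of_hasDerivWithinAt_nonpos
    (f' := fun r => -(rectProj l₀ (u r)).2 / r) (convex_Icc a T) hu.continuousOn.fst ?_ ?_ <;>
    rw [interior_Icc] <;> intro r hr
  · exact (hasDerivAt_fst_comp (hu.hasDerivAt hr)).hasDerivWithinAt
  · exact div_nonpos_of_nonpos_of_nonneg (neg_nonpos.2 (rectProj_mem hl₀ _).2.1)
      (ha.trans hr.1).le

theorem mem_rect (hu : SolvesClamped B₁ G₁ l₀ a T u) (hyp : ContinuationHyp B₁ G₁ l₀)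
    (hl₀ : 0 ≤ l₀) (ha : 0 < a) (hua₁ : (u a).1 ≤ l₀) (hua₂ : (u a).2 ∈ Ioo (0 : ℝ) 1) {r : ℝ}
    (hr : r ∈ Icc a T) (hur : 0 ≤ (u r).1) : u r ∈ rect l₀ :=
  ⟨⟨hur, (hu.antitoneOn_fst hl₀ ha ⟨le_rfl, hr.1.trans hr.2⟩ hr hr.1).trans hua₁⟩,
    (hu.snd_pos hyp hl₀ ha hua₂.1 r hr).le, (hu.snd_lt_one hyp hl₀ ha hua₂.2 r hr).le⟩

theorem solvesAt (hu : SolvesClamped B₁ G₁ l₀ a T u) {r : ℝ} (hr : r ∈ Ioo a T)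
    (hur : u r ∈ rect l₀) : SolvesAt (timesY B₁) (timesY G₁) u r := by
  have := hu.hasDerivAt hr
  rwa [rectProj_of_mem hur] at this

end SolvesClamped

theorem lyapunov_deriv_nonpos {N θ β γ v : ℝ} (hN : 0 ≤ N) (hθ : θ * (N + 1) = 1 / 4)
    (hβ : |β| ≤ N) (hv : v ∈ Icc (0 : ℝ) 1) (hγ : 0 ≤ (1 - v) * γ)
    (hγ' : v ≤ 1 / 2 → N + 1 ≤ γ) :
    -v - θ * (-((1 - v) * β) * v + (1 - v) * γ) + θ / 2 ≤ 0 := by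
  obtain ⟨hv0, hv1⟩ := hv
  have hθ0 : 0 < θ := by nlinarith
  have hβv : β * v ≤ N := by nlinarith [abs_le.1 hβ]
  rcases le_or_gt v (1 / 2) with hv | hv
  · have : 1 / 2 * 1 ≤ (1 - v) * (-(β * v) + γ) :=
      mul_le_mul (by linarith) (by linarith [hγ' hv]) zero_le_one (by linarith)
    nlinarith [mul_le_mul_of_nonneg_left this hθ0.le]
  · have : -N ≤ -((1 - v) * β) * v + (1 - v) * γ := by nlinarith
    nlinarith [mul_le_mul_of_nonneg_left this hθ0.le]

/-- The Lyapunov function which forces `ℓ` to vanish at a finite radius. -/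
def lyapunov (θ : ℝ) (u : ℝ → ℝ × ℝ) (r : ℝ) : ℝ :=
  (u r).1 - θ * (u r).2 + θ / 2 * Real.log r

theorem ContinuationHyp.exists_antitoneOn_lyapunov (hyp : ContinuationHyp B₁ G₁ l₀)
    (hl₀ : 0 ≤ l₀) :
    ∃ θ > 0, ∃ s₀ > 0, ∀ (s T : ℝ) (u : ℝ → ℝ × ℝ), s₀ ≤ s → ContinuousOn u (Icc s T) →
      (∀ r ∈ Icc s T, u r ∈ rect l₀) →
      (∀ r ∈ Ioo s T, SolvesAt (timesY B₁) (timesY G₁) u r) →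
      AntitoneOn (lyapunov θ u) (Icc s T) := by
  obtain ⟨N, hN⟩ := (isCompact_rect l₀).exists_bound_of_continuousOn hyp.B₁_C1.continuousOn
  have hN0 : 0 ≤ N := (norm_nonneg _).trans (hN _ (rectProj_mem hl₀ 0))
  obtain ⟨g, hg, hgle⟩ : ∃ g > 0, ∀ p ∈ rect l₀, p.2 ≤ 1 / 2 → g ≤ G₁ p := by
    have hsub : Icc 0 l₀ ×ˢ Icc 0 (1 / 2 : ℝ) ⊆ rect l₀ :=
      prod_mono_right (Icc_subset_Icc_right (by norm_num))
    obtain ⟨p, hp, hmin⟩ := (isCompact_Icc.prod isCompact_Icc).exists_isMinOn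
      ⟨((0 : ℝ), (0 : ℝ)), ⟨le_rfl, hl₀⟩, ⟨le_rfl, by norm_num⟩⟩ (hyp.G₁_cont.mono hsub)
    exact ⟨G₁ p, hyp.G₁_pos p (hsub hp) (hp.2.2.trans_lt (by norm_num)),
      fun q hq hq2 => hmin ⟨hq.1, hq.2.1, hq2⟩⟩
  refine ⟨1 / (4 * (N + 1)), by positivity, √((N + 1) / g), by positivity,
    fun s T u hs hc hmem hsol => ?_⟩
  set θ := 1 / (4 * (N + 1)) with hθ
  have hs0 : 0 < s := (show 0 < √((N + 1) / g) by positivity).trans_le hs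
  have hs_sq : N + 1 ≤ s ^ 2 * g := (div_le_iff₀ hg).1 ((Real.sqrt_le_left hs0.le).1 hs)
  have hlog : ContinuousOn Real.log (Icc s T) :=
    Real.continuousOn_log.mono fun r hr => (hs0.trans_le hr.1).ne'
  refine antitoneOn_of_hasDerivWithinAt_nonpos (f' := fun r => -(u r).2 / r -
      θ * ((-timesY B₁ (u r) * (u r).2 + r ^ 2 * timesY G₁ (u r)) / r) + θ / 2 * r⁻¹)
    (convex_Icc s T) ((hc.fst.sub (continuousOn_const.mul hc.snd)).add
      (continuousOn_const.mul hlog)) ?_ ?_ <;> rw [interior_Icc] <;> intro r hr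
  · exact (((hsol r hr).hasDerivAt_fst.sub ((hsol r hr).hasDerivAt_snd.const_mul θ)).add
      ((Real.hasDerivAt_log (hs0.trans hr.1).ne').const_mul (θ / 2))).hasDerivWithinAt
  · have hr0 : 0 < r := hs0.trans hr.1
    have hm : u r ∈ rect l₀ := hmem r (Ioo_subset_Icc_self hr)
    have key := lyapunov_deriv_nonpos (γ := r ^ 2 * G₁ (u r)) hN0
      (show θ * (N + 1) = 1 / 4 by rw [hθ]; field_simp) (hN _ hm) hm.2
      (by simpa only [timesY, mul_left_comm] using
        mul_nonneg (sq_nonneg r) (hyp.timesY_nonneg hm))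
      fun hv => hs_sq.trans (by gcongr; exacts [hr.1.le, hgle _ hm hv])
    refine (div_nonpos_of_nonpos_of_nonneg key hr0.le).trans_eq' ?_
    simp only [timesY]
    ring

/-- The term `θ / 2 * log r` of the Lyapunov function is unbounded, the others are not. -/
theorem ContinuationHyp.exists_radius_bound (hyp : ContinuationHyp B₁ G₁ l₀) (hl₀ : 0 ≤ l₀)
    (a : ℝ) :
    ∃ T ≥ a, ∀ u : ℝ → ℝ × ℝ, ContinuousOn u (Icc a T) →
      (∀ r ∈ Ioo a T, u r ∈ rect l₀ → SolvesAt (timesY B₁) (timesY G₁) u r) →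
      ∃ r ∈ Icc a T, u r ∉ rect l₀ := by
  obtain ⟨θ, hθ, s₀, hs₀, hanti⟩ := hyp.exists_antitoneOn_lyapunov hl₀
  set s := max a s₀
  have hs : 0 < s := lt_max_of_lt_right hs₀
  set T := s * Real.exp ((l₀ + θ + 1) / (θ / 2)) with hT
  have hsT : s ≤ T := le_mul_of_one_le_right hs.le (Real.one_le_exp (by positivity))
  refine ⟨T, (le_max_left a s₀).trans hsT, fun u hc hsol => ?_⟩
  by_contra! hmem
  have hsub : Icc s T ⊆ Icc a T := Icc_subset_Icc_left (le_max_left _ _)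
  have h := hanti s T u (le_max_right _ _) (hc.mono hsub) (fun r hr => hmem r (hsub hr))
    (fun r hr => hsol r ⟨(le_max_left _ _).trans_lt hr.1, hr.2⟩
      (hmem r (hsub (Ioo_subset_Icc_self hr)))) (left_mem_Icc.2 hsT) (right_mem_Icc.2 hsT) hsT
  have hlog : θ / 2 * Real.log T = θ / 2 * Real.log s + (l₀ + θ + 1) := by
    rw [hT, Real.log_mul hs.ne' (Real.exp_ne_zero _), Real.log_exp]
    field_simp
  have hus := hmem s (hsub (left_mem_Icc.2 hsT))
  have huT := hmem T (hsub (right_mem_Icc.2 hsT))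
  simp only [lyapunov, hlog] at h
  linarith [hus.1.2, huT.1.1, mul_nonneg hθ.le hus.2.1, mul_le_of_le_one_right hθ.le huT.2.2]

theorem ContinuationHyp.exists_continuation (hyp : ContinuationHyp B₁ G₁ l₀) (ha : 0 < a)
    {p : ℝ × ℝ} (hp₁ : p.1 ∈ Ioc 0 l₀) (hp₂ : p.2 ∈ Ioo (0 : ℝ) 1) :
    ∃ b > a, ∃ u : ℝ → ℝ × ℝ, u a = p ∧ (u b).1 = 0 ∧ (∀ r ∈ Ico a b, 0 < (u r).1) ∧
      (∀ r ∈ Icc a b, (u r).2 ∈ Ioo (0 : ℝ) 1) ∧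
      ∀ r ∈ Icc a b,
        HasDerivWithinAt u (structureField (timesY B₁) (timesY G₁) r (u r)) (Icc a b) r := by
  have hl₀ : 0 ≤ l₀ := hp₁.1.le.trans hp₁.2
  obtain ⟨T, haT, hT⟩ := hyp.exists_radius_bound hl₀ a
  obtain ⟨u, rfl, hu⟩ := hyp.exists_solvesClamped hl₀ ha haT p
  have hmem {r : ℝ} := hu.mem_rect (r := r) hyp hl₀ ha hp₁.2 hp₂
  obtain ⟨t, ht, htu⟩ := hT u hu.continuousOn fun r hr hur => hu.solvesAt hr hur
  have hlt : (u t).1 < 0 := not_le.1 fun h => htu (hmem ht h)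
  obtain ⟨b, hb, hb0, hpos⟩ := exists_first_zero ht.1
    (hu.continuousOn.fst.mono (Icc_subset_Icc_right ht.2)) hp₁.1 hlt.le
  have hbT : Icc a b ⊆ Icc a T := Icc_subset_Icc_right (hb.2.trans ht.2)
  refine ⟨b, hb.1, u, rfl, hb0, hpos, fun r hr => ⟨hu.snd_pos hyp hl₀ ha hp₂.1 r (hbT hr),
    hu.snd_lt_one hyp hl₀ ha hp₂.2 r (hbT hr)⟩, fun r hr => ?_⟩
  have hur : 0 ≤ (u r).1 := by
    rcases hr.2.eq_or_lt with rfl | h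
    · exact hb0.ge
    · exact (hpos r ⟨hr.1, h⟩).le
  have := hu r (hbT hr)
  rw [rectProj_of_mem (hmem (hbT hr) hur)] at this
  exact this.mono hbT

end Continuation

section GlobalExistence

theorem exists_glued_solution {E : Type*} [NormedAddCommGroup E] [NormedSpace ℝ E]
    {f : ℝ → E → E} {u₁ u₂ : ℝ → E} {c a b : ℝ} (hca : c ≤ a) (hab : a < b) (h : u₁ a = u₂ a)
    (hc : ContinuousOn u₁ (Icc c a)) (h₁ : ∀ r ∈ Ioc c a, HasDerivAt u₁ (f r (u₁ r)) r)
    (h₂ : ∀ r ∈ Icc a b, HasDerivWithinAt u₂ (f r (u₂ r)) (Icc a b) r) :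
    ∃ u : ℝ → E, EqOn u u₁ (Iic a) ∧ EqOn u u₂ (Ici a) ∧ ContinuousOn u (Icc c b) ∧
      ∀ r ∈ Ioo c b, HasDerivAt u (f r (u r)) r := by
  classical
  set u := (Iic a).piecewise u₁ u₂
  have e₁ : EqOn u u₁ (Iic a) := (Iic a).piecewise_eqOn u₁ u₂
  have e₂ : EqOn u u₂ (Ici a) := fun r hr => by
    rcases (mem_Ici.1 hr).eq_or_lt with rfl | hr
    · exact (e₁ self_mem_Iic).trans h
    · exact (Iic a).piecewise_eqOn_compl u₁ u₂ (notMem_Iic.2 hr)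
  refine ⟨u, e₁, e₂, ?_, fun r hr => ?_⟩
  · rw [← Icc_union_Icc_eq_Icc hca hab.le]
    exact (hc.congr (e₁.mono Icc_subset_Iic_self)).union_of_isClosed
      (ContinuousOn.congr (fun r hr => (h₂ r hr).continuousWithinAt) (e₂.mono Icc_subset_Ici_self))
      isClosed_Icc isClosed_Icc
  · rcases lt_trichotomy r a with hra | rfl | hra
    · rw [e₁ hra.le]
      exact (h₁ r ⟨hr.1, hra.le⟩).congr_of_eventuallyEq (e₁.eventuallyEq_of_mem (Iic_mem_nhds hra))
    · have left := (h₁ r ⟨hr.1, le_rfl⟩).hasDerivWithinAt.congr e₁ (e₁ self_mem_Iic)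
      have right := ((h₂ r ⟨le_rfl, hab.le⟩).mono_of_mem_nhdsWithin (Icc_mem_nhdsGE hab)).congr e₂
        (e₂ self_mem_Ici)
      rw [← e₁ self_mem_Iic] at left
      rw [← e₂ self_mem_Ici] at right
      simpa using left.union right
    · rw [e₂ hra.le]
      exact ((h₂ r ⟨hra.le, hr.2.le⟩).hasDerivAt (Icc_mem_nhds hra hr.2)).congr_of_eventuallyEq
        (e₂.eventuallyEq_of_mem (Ici_mem_nhds hra))

/-- A solution of the structure equations with `ℓ(0) = l₀` and `v(0) = 0` which first reaches
`ℓ = 0` at the radius `b`. -/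
structure IsStructureCurve (B G : ℝ × ℝ → ℝ) (l₀ b : ℝ) (u : ℝ → ℝ × ℝ) : Prop where
  radius_pos : 0 < b
  continuousOn : ContinuousOn u (Icc 0 b)
  center : u 0 = (l₀, 0)
  solvesAt : ∀ r ∈ Ioo 0 b, SolvesAt B G u r
  snd_mem : ∀ r ∈ Ioc 0 b, (u r).2 ∈ Ioo (0 : ℝ) 1
  fst_pos : ∀ r ∈ Ico 0 b, 0 < (u r).1
  fst_eq_zero : (u b).1 = 0

variable {B G : ℝ × ℝ → ℝ} {u : ℝ → ℝ × ℝ} {b l₀ : ℝ}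

theorem strictAntiOn_fst_of_solvesAt (hu : ContinuousOn u (Icc 0 b))
    (hsol : ∀ r ∈ Ioo 0 b, SolvesAt B G u r) (hpos : ∀ r ∈ Ioo 0 b, 0 < (u r).2) :
    StrictAntiOn (fun r => (u r).1) (Icc 0 b) := by
  refine strictAntiOn_of_hasDerivWithinAt_neg (f' := fun r => -(u r).2 / r) (convex_Icc 0 b)
    hu.fst ?_ ?_ <;> rw [interior_Icc] <;> intro r hr
  · exact (hsol r hr).hasDerivAt_fst.hasDerivWithinAt
  · exact div_neg_of_neg_of_pos (neg_neg_of_pos (hpos r hr)) hr.1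

theorem IsStructureCurve.fst_lt (hu : IsStructureCurve B G l₀ b u) {r : ℝ} (hr : r ∈ Ioc 0 b) :
    (u r).1 < l₀ := by
  have := strictAntiOn_fst_of_solvesAt hu.continuousOn hu.solvesAt
    (fun t ht => (hu.snd_mem t (Ioo_subset_Ioc_self ht)).1) ⟨le_rfl, hu.radius_pos.le⟩
    (Ioc_subset_Icc_self hr) hr.1
  simpa only [hu.center] using this

theorem ContinuationHyp.exists_isStructureCurve {B₁ G₁ : ℝ × ℝ → ℝ}
    (hyp : ContinuationHyp B₁ G₁ l₀) (hl₀ : 0 < l₀) (hB : ContDiffAt ℝ 1 (timesY B₁) (l₀, 0))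
    (hG : ContDiffAt ℝ 1 (timesY G₁) (l₀, 0)) (hB0 : 0 ≤ timesY B₁ (l₀, 0))
    (hG0 : 0 < timesY G₁ (l₀, 0)) :
    ∃ b u, IsStructureCurve (timesY B₁) (timesY G₁) l₀ b u := by
  obtain ⟨h, hh, u₁, hu₁, hu₁0, hsol⟩ := exists_solution_center hB hG hB0 hG0
  have hnear : ∀ᶠ r in 𝓝 (0 : ℝ), (u₁ r).1 ∈ Ioi 0 ∧ (u₁ r).2 ∈ Iio 1 :=
    (hu₁.fst.continuousAt.eventually (Ioi_mem_nhds (by simpa [hu₁0] using hl₀))).and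
      (hu₁.snd.continuousAt.eventually (Iio_mem_nhds (by simp [hu₁0])))
  obtain ⟨ε, hε, hball⟩ := Metric.eventually_nhds_iff.1 hnear
  obtain ⟨a, ha, ha'⟩ := exists_between (lt_min hh hε)
  have hrect : ∀ r ∈ Icc 0 a, 0 < (u₁ r).1 ∧ (u₁ r).2 < 1 := fun r hr =>
    hball (by simpa [abs_of_nonneg hr.1] using hr.2.trans_lt (ha'.trans_le (min_le_right _ _)))
  have hsol' : ∀ r ∈ Ioc 0 a, SolvesAt _ _ u₁ r ∧ 0 < (u₁ r).2 := fun r hr =>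
    hsol r ⟨hr.1, hr.2.trans_lt (ha'.trans_le (min_le_left _ _))⟩
  have haa : a ∈ Icc 0 a := ⟨ha.le, le_rfl⟩
  have hfst : (u₁ a).1 < l₀ := by
    simpa [hu₁0] using strictAntiOn_fst_of_solvesAt hu₁.continuousOn
      (fun r hr => (hsol' r (Ioo_subset_Ioc_self hr)).1)
      (fun r hr => (hsol' r (Ioo_subset_Ioc_self hr)).2) ⟨le_rfl, ha.le⟩ haa ha
  obtain ⟨b, hab, u₂, hu₂a, hu₂b, hpos, hmem, hode⟩ := hyp.exists_continuation ha
    ⟨(hrect a haa).1, hfst.le⟩ ⟨(hsol' a ⟨ha, le_rfl⟩).2, (hrect a haa).2⟩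
  obtain ⟨u, e₁, e₂, hc, hd⟩ := exists_glued_solution ha.le hab hu₂a.symm hu₁.continuousOn
    (fun r hr => (hsol' r hr).1) hode
  refine ⟨b, u, ha.trans hab, hc, (e₁ ha.le).trans hu₁0, hd, fun r hr => ?_, fun r hr => ?_,
    by rw [e₂ hab.le, hu₂b]⟩
  · rcases le_total r a with hra | hra
    · rw [e₁ hra]
      exact ⟨(hsol' r ⟨hr.1, hra⟩).2, (hrect r ⟨hr.1.le, hra⟩).2⟩
    · rw [e₂ hra]
      exact hmem r ⟨hra, hr.2⟩
  · rcases le_total r a with hra | hra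
    · rw [e₁ hra]
      exact (hrect r ⟨hr.1, hra⟩).1
    · rw [e₂ hra]
      exact hpos r ⟨hra, hr.2⟩

end GlobalExistence

section Uniqueness

theorem eventuallyEq_of_hasDerivAt {E : Type*} [NormedAddCommGroup E] [NormedSpace ℝ E]
    {f : ℝ → E → E} {u₁ u₂ : ℝ → E} {t : ℝ} (hf : ContDiffAt ℝ 1 (Function.uncurry f) (t, u₁ t))
    (h₁ : ∀ᶠ r in 𝓝 t, HasDerivAt u₁ (f r (u₁ r)) r)
    (h₂ : ∀ᶠ r in 𝓝 t, HasDerivAt u₂ (f r (u₂ r)) r) (h : u₁ t = u₂ t) : u₁ =ᶠ[𝓝 t] u₂ := by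
  obtain ⟨K, S, hS, hK⟩ := hf.exists_lipschitzOnWith
  obtain ⟨I, hI, W, hW, hIW⟩ := mem_nhds_prod_iff.1 hS
  have hlip : ∀ᶠ r in 𝓝 t, LipschitzOnWith K (f r) W := by
    filter_upwards [hI] with r hr
    intro p hp q hq
    simpa [Prod.edist_eq] using hK (hIW (mk_mem_prod hr hp)) (hIW (mk_mem_prod hr hq))
  refine ODE_solution_unique_of_eventually (s := fun _ => W) hlip
    (h₁.and (h₁.self_of_nhds.continuousAt.eventually hW))
    (h₂.and (h₂.self_of_nhds.continuousAt.eventually (h ▸ hW))) h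

theorem eqOn_Icc_of_eventuallyEq {X : Type*} [TopologicalSpace X] [T2Space X] {u₁ u₂ : ℝ → X}
    {a b : ℝ} (h₁ : ContinuousOn u₁ (Icc a b)) (h₂ : ContinuousOn u₂ (Icc a b))
    (ha : u₁ a = u₂ a) (h : ∀ r ∈ Ico a b, u₁ r = u₂ r → u₁ =ᶠ[𝓝[>] r] u₂) :
    EqOn u₁ u₂ (Icc a b) := by
  have hclosed : IsClosed ({r | u₁ r = u₂ r} ∩ Icc a b) := by
    rw [inter_comm]
    exact (h₁.prodMk h₂).preimage_isClosed_of_isClosed isClosed_Icc isClosed_diagonal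
  exact hclosed.Icc_subset_of_forall_mem_nhdsWithin ha fun r hr => h r hr.2 hr.1

variable {B G : ℝ × ℝ → ℝ} {l₀ h : ℝ} {s : Set (ℝ × ℝ)} {u u₁ u₂ : ℝ → ℝ × ℝ}

/-- `u` solves the structure equations near the center, with values in `s`. -/
structure SolvesNearCenter (B G : ℝ × ℝ → ℝ) (l₀ : ℝ) (s : Set (ℝ × ℝ)) (h : ℝ)
    (u : ℝ → ℝ × ℝ) : Prop where
  continuousOn : ContinuousOn u (Icc 0 h)
  center : u 0 = (l₀, 0)
  mem : ∀ r ∈ Ioo 0 h, u r ∈ s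
  solvesAt : ∀ r ∈ Ioo 0 h, SolvesAt B G u r

theorem SolvesNearCenter.abs_snd_le (hu : SolvesNearCenter B G l₀ s h u) {M : ℝ}
    (hB : ∀ p ∈ s, 0 ≤ B p) (hG : ∀ p ∈ s, |G p| ≤ M) :
    ∀ r ∈ Icc 0 h, |(u r).2| ≤ M / 2 * r ^ 2 := by
  refine abs_le_mul_sq_of_deriv_damped (e := fun r => r * G (u r)) (g := fun r => B (u r) / r)
    hu.continuousOn.snd (by rw [hu.center]) (fun r hr => ?_)
    (fun r hr => div_nonneg (hB _ (hu.mem r hr)) hr.1.le) fun r hr => ?_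
  · refine (hu.solvesAt r hr).hasDerivAt_snd.congr_deriv ?_
    have := hr.1.ne'
    field_simp
    ring
  · rw [abs_mul, abs_of_pos hr.1]
    linarith [mul_le_mul_of_nonneg_left (hG _ (hu.mem r hr)) hr.1.le]

theorem SolvesNearCenter.abs_snd_sub_le (hu₁ : SolvesNearCenter B G l₀ s h u₁)
    (hu₂ : SolvesNearCenter B G l₀ s h u₂) {L : ℝ≥0} {M D : ℝ} (hB : ∀ p ∈ s, 0 ≤ B p)
    (hG : ∀ p ∈ s, |G p| ≤ M) (hBL : LipschitzOnWith L B s) (hGL : LipschitzOnWith L G s)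
    (hD : ∀ r ∈ Icc 0 h, ‖u₁ r - u₂ r‖ ≤ D) :
    ∀ r ∈ Icc 0 h, |(u₁ r).2 - (u₂ r).2| ≤ L * D * (2 + M) / 4 * r ^ 2 := by
  have hlip {f : ℝ × ℝ → ℝ} (hf : LipschitzOnWith L f s) {r : ℝ} (hr : r ∈ Ioo 0 h) :
      |f (u₁ r) - f (u₂ r)| ≤ L * D :=
    (hf.dist_le_mul _ (hu₁.mem r hr) _ (hu₂.mem r hr)).trans
      (by gcongr; simpa [dist_eq_norm] using hD r (Ioo_subset_Icc_self hr))
  refine abs_le_mul_sq_of_deriv_damped (f := fun r => (u₁ r).2 - (u₂ r).2)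
    (e := fun r => r * (G (u₁ r) - G (u₂ r)) - (B (u₁ r) - B (u₂ r)) * ((u₂ r).2 / r))
    (g := fun r => B (u₁ r) / r) (hu₁.continuousOn.snd.sub hu₂.continuousOn.snd)
    (by rw [hu₁.center, hu₂.center, sub_self]) (fun r hr => ?_)
    (fun r hr => div_nonneg (hB _ (hu₁.mem r hr)) hr.1.le) fun r hr => ?_
  · refine ((hu₁.solvesAt r hr).hasDerivAt_snd.sub
      (hu₂.solvesAt r hr).hasDerivAt_snd).congr_deriv ?_
    have := hr.1.ne'
    field_simp
    ring
  · have hv : |(u₂ r).2 / r| ≤ M / 2 * r := by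
      rw [abs_div, abs_of_pos hr.1, div_le_iff₀ hr.1]
      linarith [hu₂.abs_snd_le hB hG r (Ioo_subset_Icc_self hr)]
    calc |r * (G (u₁ r) - G (u₂ r)) - (B (u₁ r) - B (u₂ r)) * ((u₂ r).2 / r)|
        ≤ r * |G (u₁ r) - G (u₂ r)| + |B (u₁ r) - B (u₂ r)| * |(u₂ r).2 / r| := by
          refine (abs_sub _ _).trans_eq ?_
          rw [abs_mul, abs_mul, abs_of_pos hr.1]
      _ ≤ r * (L * D) + L * D * (M / 2 * r) := add_le_add
          (mul_le_mul_of_nonneg_left (hlip hGL hr) hr.1.le)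
          (mul_le_mul (hlip hBL hr) hv (abs_nonneg _) ((abs_nonneg _).trans (hlip hBL hr)))
      _ = 2 * (L * D * (2 + M) / 4) * r := by ring

theorem SolvesNearCenter.norm_sub_le (hu₁ : SolvesNearCenter B G l₀ s h u₁)
    (hu₂ : SolvesNearCenter B G l₀ s h u₂) {N : ℝ}
    (hN : ∀ r ∈ Icc 0 h, |(u₁ r).2 - (u₂ r).2| ≤ N * r ^ 2) :
    ∀ r ∈ Icc 0 h, ‖u₁ r - u₂ r‖ ≤ N * r ^ 2 := by
  have fst_le : ∀ r ∈ Icc 0 h, |(u₁ r).1 - (u₂ r).1| ≤ N / 2 * r ^ 2 := by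
    refine abs_le_mul_sq_of_deriv_damped (f := fun r => (u₁ r).1 - (u₂ r).1)
      (e := fun r => -((u₁ r).2 - (u₂ r).2) / r) (g := 0)
      (hu₁.continuousOn.fst.sub hu₂.continuousOn.fst) (by rw [hu₁.center, hu₂.center, sub_self])
      (fun r hr => ?_) (fun _ _ => le_rfl) fun r hr => ?_
    · refine ((hu₁.solvesAt r hr).hasDerivAt_fst.sub
        (hu₂.solvesAt r hr).hasDerivAt_fst).congr_deriv ?_
      simp only [Pi.zero_apply]
      ring
    · rw [abs_div, abs_neg, abs_of_pos hr.1, div_le_iff₀ hr.1]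
      linarith [hN r (Ioo_subset_Icc_self hr)]
  exact fun r hr => max_le
    ((fst_le r hr).trans (by linarith [(abs_nonneg _).trans (fst_le r hr)])) (hN r hr)

theorem SolvesNearCenter.eqOn (hu₁ : SolvesNearCenter B G l₀ s h u₁)
    (hu₂ : SolvesNearCenter B G l₀ s h u₂) {L : ℝ≥0} {M : ℝ} (hB : ∀ p ∈ s, 0 ≤ B p)
    (hG : ∀ p ∈ s, |G p| ≤ M) (hBL : LipschitzOnWith L B s) (hGL : LipschitzOnWith L G s)
    (hM : 0 ≤ M) (hsmall : L * (2 + M) * h ^ 2 ≤ 2) : EqOn u₁ u₂ (Icc 0 h) := by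
  intro t ht
  obtain ⟨r, hr, hmax⟩ := isCompact_Icc.exists_isMaxOn ⟨t, ht⟩
    (hu₁.continuousOn.sub hu₂.continuousOn).norm
  set D := ‖u₁ r - u₂ r‖
  have hle : D ≤ L * D * (2 + M) / 4 * r ^ 2 :=
    hu₁.norm_sub_le hu₂ (hu₁.abs_snd_sub_le hu₂ hB hG hBL hGL hmax) r hr
  have : L * D * (2 + M) / 4 * r ^ 2 ≤ D / 2 := calc
    L * D * (2 + M) / 4 * r ^ 2 ≤ L * D * (2 + M) / 4 * h ^ 2 := by
      gcongr
      exacts [hr.1, hr.2]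
    _ = L * (2 + M) * h ^ 2 * (D / 4) := by ring
    _ ≤ 2 * (D / 4) := by gcongr
    _ = D / 2 := by ring
  have hD : ‖u₁ t - u₂ t‖ ≤ D := hmax ht
  exact sub_eq_zero.1 (norm_le_zero_iff.1 (by linarith))

theorem exists_eqOn_of_solvesNearCenter (hB : ContDiffAt ℝ 1 B (l₀, 0))
    (hG : ContDiffAt ℝ 1 G (l₀, 0)) (hB0 : 0 < B (l₀, 0)) :
    ∃ s ∈ 𝓝 (l₀, (0 : ℝ)), ∃ ε > 0, ∀ h ≤ ε, ∀ u₁ u₂, SolvesNearCenter B G l₀ s h u₁ →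
      SolvesNearCenter B G l₀ s h u₂ → EqOn u₁ u₂ (Icc 0 h) := by
  obtain ⟨K₁, s₁, hs₁, hK₁⟩ := hB.exists_lipschitzOnWith
  obtain ⟨K₂, s₂, hs₂, hK₂⟩ := hG.exists_lipschitzOnWith
  have hBpos : ∀ᶠ p in 𝓝 (l₀, (0 : ℝ)), 0 < B p :=
    hB.continuousAt.eventually (lt_mem_nhds hB0)
  have hGbd : ∀ᶠ p in 𝓝 (l₀, (0 : ℝ)), |G p| < |G (l₀, 0)| + 1 :=
    hG.continuousAt.abs.eventually (gt_mem_nhds (lt_add_one _))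
  set L := max K₁ K₂
  set M := |G (l₀, 0)| + 1
  refine ⟨_, inter_mem (inter_mem hs₁ hs₂) (hBpos.and hGbd), √(2 / (L * (2 + M) + 1)),
    by positivity, fun h hh u₁ u₂ hu₁ hu₂ => ?_⟩
  rcases lt_or_ge h 0 with hneg | hh0
  · simp [Icc_eq_empty_of_lt hneg]
  refine hu₁.eqOn (L := L) (M := M) hu₂ (fun p hp => hp.2.1.le) (fun p hp => hp.2.2.le)
    ((hK₁.mono fun p hp => hp.1.1).weaken (le_max_left _ _))
    ((hK₂.mono fun p hp => hp.1.2).weaken (le_max_right _ _)) (by positivity) ?_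
  have hK : (0 : ℝ) < L * (2 + M) + 1 := by positivity
  have : h ^ 2 * (L * (2 + M) + 1) ≤ 2 :=
    (le_div_iff₀ hK).1 ((Real.le_sqrt hh0 (by positivity)).1 hh)
  linarith [sq_nonneg h]

theorem contDiffAt_structureField {p : ℝ × ℝ} {r : ℝ} (hr : r ≠ 0) (hB : ContDiffAt ℝ 1 B p)
    (hG : ContDiffAt ℝ 1 G p) :
    ContDiffAt ℝ 1 (Function.uncurry (structureField B G)) (r, p) := by
  have hB' : ContDiffAt ℝ 1 (fun q : ℝ × ℝ × ℝ => B q.2) (r, p) :=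
    ContDiffAt.comp (g := B) (r, p) hB contDiffAt_snd
  have hG' : ContDiffAt ℝ 1 (fun q : ℝ × ℝ × ℝ => G q.2) (r, p) :=
    ContDiffAt.comp (g := G) (r, p) hG contDiffAt_snd
  have hv : ContDiffAt ℝ 1 (fun q : ℝ × ℝ × ℝ => q.2.2) (r, p) := by fun_prop
  have hr' : ContDiffAt ℝ 1 (fun q : ℝ × ℝ × ℝ => q.1) (r, p) := by fun_prop
  exact (hv.neg.div hr' hr).prodMk (((hB'.neg.mul hv).add ((hr'.pow 2).mul hG')).div hr' hr)

/-- The second curve is only known to satisfy the equations as long as it stays in the domain `U`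
of regularity of the coefficients. -/
theorem eqOn_of_solvesAt {U : Set (ℝ × ℝ)} {b : ℝ} (hU : IsOpen U) (hBU : ContDiffOn ℝ 1 B U)
    (hGU : ContDiffOn ℝ 1 G U) (h0 : (l₀, (0 : ℝ)) ∈ U) (hB0 : 0 < B (l₀, 0)) (hb : 0 < b)
    (hc₁ : ContinuousOn u₁ (Icc 0 b)) (hc₂ : ContinuousOn u₂ (Icc 0 b)) (hu₁0 : u₁ 0 = (l₀, 0))
    (hu₂0 : u₂ 0 = (l₀, 0)) (h₁ : ∀ r ∈ Ioo 0 b, u₁ r ∈ U ∧ SolvesAt B G u₁ r)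
    (h₂ : ∀ r ∈ Ioo 0 b, u₂ r ∈ U → SolvesAt B G u₂ r) : EqOn u₁ u₂ (Icc 0 b) := by
  have hB : ∀ p ∈ U, ContDiffAt ℝ 1 B p := fun p hp => hBU.contDiffAt (hU.mem_nhds hp)
  have hG : ∀ p ∈ U, ContDiffAt ℝ 1 G p := fun p hp => hGU.contDiffAt (hU.mem_nhds hp)
  refine eqOn_Icc_of_eventuallyEq hc₁ hc₂ (hu₁0.trans hu₂0.symm) fun r hr heq => ?_
  rcases hr.1.eq_or_lt with rfl | hr0
  · obtain ⟨s, hs, ε, hε, huniq⟩ := exists_eqOn_of_solvesNearCenter (hB _ h0) (hG _ h0) hB0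
    have near {u : ℝ → ℝ × ℝ} (hc : ContinuousOn u (Icc 0 b)) (hu : u 0 = (l₀, 0)) :
        ∀ᶠ r in 𝓝[>] (0 : ℝ), u r ∈ U ∩ s := by
      have hle : 𝓝[>] (0 : ℝ) ≤ 𝓝[Icc 0 b] 0 := by
        rw [← nhdsWithin_Ioo_eq_nhdsGT hb]
        exact nhdsWithin_mono _ Ioo_subset_Icc_self
      exact ((hc 0 ⟨le_rfl, hb.le⟩).eventually (by rw [hu]; exact inter_mem (hU.mem_nhds h0) hs))
        |>.filter_mono hle
    obtain ⟨h, hh, hsub⟩ := mem_nhdsGT_iff_exists_Ioo_subset.1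
      ((near hc₁ hu₁0).and (near hc₂ hu₂0))
    have hh' : 0 < min (min h ε) b := lt_min (lt_min hh hε) hb
    have mem (r) (hr : r ∈ Ioo 0 (min (min h ε) b)) : r ∈ Ioo 0 h ∧ r ∈ Ioo 0 b := by
      simp only [lt_inf_iff, mem_Ioo] at hr ⊢
      tauto
    have hcI : Icc 0 (min (min h ε) b) ⊆ Icc 0 b := Icc_subset_Icc_right (min_le_right _ _)
    have := huniq _ ((min_le_left _ _).trans (min_le_right _ _)) u₁ u₂
      ⟨hc₁.mono hcI, hu₁0, fun r hr => (hsub (mem r hr).1).1.2, fun r hr => (h₁ r (mem r hr).2).2⟩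
      ⟨hc₂.mono hcI, hu₂0, fun r hr => (hsub (mem r hr).1).2.2,
        fun r hr => h₂ r (mem r hr).2 (hsub (mem r hr).1).2.1⟩
    exact this.eventuallyEq_of_mem (Icc_mem_nhdsGT hh')
  · have hrb : r ∈ Ioo 0 b := ⟨hr0, hr.2⟩
    have hnb : Ioo 0 b ∈ 𝓝 r := isOpen_Ioo.mem_nhds hrb
    have hU₂ : ∀ᶠ t in 𝓝 r, u₂ t ∈ U :=
      (hc₂.continuousAt (mem_of_superset hnb Ioo_subset_Icc_self)).eventually
        (heq ▸ hU.mem_nhds (h₁ r hrb).1)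
    refine (eventuallyEq_of_hasDerivAt (f := structureField B G)
      (contDiffAt_structureField hr0.ne' (hB _ (h₁ r hrb).1) (hG _ (h₁ r hrb).1)) ?_ ?_
      heq).filter_mono nhdsWithin_le_nhds
    · filter_upwards [hnb] with t ht using (h₁ t ht).2
    · filter_upwards [hnb, hU₂] with t ht htU using h₂ t ht htU

end Uniqueness

section Coefficients

/-- A function of `(x, y)` in the variables `ℓ = log x`, `v = 1 - y`. -/
def inLV (P : ℝ → ℝ → ℝ) (p : ℝ × ℝ) : ℝ :=
  P (Real.exp p.1) (1 - p.2)

/-- The coefficient `B₁ = B / y` of the structure equations. -/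
def coefB₁ (Γ Υ : ℝ → ℝ → ℝ) (p : ℝ × ℝ) : ℝ :=
  inLV Υ p / inLV Γ p

/-- The coefficient `G₁ = G / y` of the structure equations for the reference density `K`, where
`κ` is the factor which normalizes `Γ`. -/
def coefG₁ (Γ : ℝ → ℝ → ℝ) (κ a b K : ℝ) (p : ℝ × ℝ) : ℝ :=
  4 * Real.pi / 3 * K ^ 2 * κ⁻¹ * Real.exp p.1 ^ a * Real.exp p.1 ^ 6 * (1 - p.2) ^ b / inLV Γ p

/-- The coefficient `B` of the structure equations. -/
abbrev coefB (Γ Υ : ℝ → ℝ → ℝ) : ℝ × ℝ → ℝ :=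
  timesY (coefB₁ Γ Υ)

/-- The coefficient `G` of the structure equations. -/
abbrev coefG (Γ : ℝ → ℝ → ℝ) (κ a b K : ℝ) : ℝ × ℝ → ℝ :=
  timesY (coefG₁ Γ κ a b K)

/-- The part of the phase space where `y > 0` and the coefficients are regular. -/
def regularDomain (Γ : ℝ → ℝ → ℝ) : Set (ℝ × ℝ) :=
  {p | p.2 < 1 ∧ 0 < inLV Γ p}

variable {P Γ Υ : ℝ → ℝ → ℝ} {κ a b K : ℝ} {s : Set (ℝ × ℝ)}

theorem contDiffOn_inLV (hP : ContDiffOn ℝ 1 (Function.uncurry P) (Ioi 0 ×ˢ Ici 0))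
    (hs : s ⊆ {p | p.2 ≤ 1}) : ContDiffOn ℝ 1 (inLV P) s := by
  have : ContDiff ℝ 1 (fun p : ℝ × ℝ => (Real.exp p.1, 1 - p.2)) := by fun_prop
  have hs' (p : ℝ × ℝ) (hp : p ∈ s) : p.2 ≤ 1 := hs hp
  exact hP.comp this.contDiffOn fun p hp => ⟨Real.exp_pos _, sub_nonneg.2 (hs' p hp)⟩

theorem isOpen_regularDomain (hΓ : ContDiffOn ℝ 1 (Function.uncurry Γ) (Ioi 0 ×ˢ Ici 0)) :
    IsOpen (regularDomain Γ) :=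
  (contDiffOn_inLV hΓ fun _ (hp : _ < _) => hp.le).continuousOn.isOpen_inter_preimage
    (isOpen_lt continuous_snd continuous_const) isOpen_Ioi

theorem contDiffOn_coefB₁ (hΓ : ContDiffOn ℝ 1 (Function.uncurry Γ) (Ioi 0 ×ˢ Ici 0))
    (hΥ : ContDiffOn ℝ 1 (Function.uncurry Υ) (Ioi 0 ×ˢ Ici 0)) (hs : s ⊆ {p | p.2 ≤ 1})
    (h0 : ∀ p ∈ s, inLV Γ p ≠ 0) : ContDiffOn ℝ 1 (coefB₁ Γ Υ) s :=
  (contDiffOn_inLV hΥ hs).div (contDiffOn_inLV hΓ hs) h0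

theorem contDiffOn_coefB (hΓ : ContDiffOn ℝ 1 (Function.uncurry Γ) (Ioi 0 ×ˢ Ici 0))
    (hΥ : ContDiffOn ℝ 1 (Function.uncurry Υ) (Ioi 0 ×ˢ Ici 0)) (hs : s ⊆ {p | p.2 ≤ 1})
    (h0 : ∀ p ∈ s, inLV Γ p ≠ 0) : ContDiffOn ℝ 1 (coefB Γ Υ) s :=
  (contDiff_const.sub contDiff_snd).contDiffOn.mul (contDiffOn_coefB₁ hΓ hΥ hs h0)

theorem continuousOn_coefG₁ (hΓ : ContDiffOn ℝ 1 (Function.uncurry Γ) (Ioi 0 ×ˢ Ici 0))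
    (hb : 0 ≤ b) (hs : s ⊆ {p | p.2 ≤ 1}) (h0 : ∀ p ∈ s, inLV Γ p ≠ 0) :
    ContinuousOn (coefG₁ Γ κ a b K) s := by
  refine ContinuousOn.div (Continuous.continuousOn ?_) (contDiffOn_inLV hΓ hs).continuousOn h0
  refine Continuous.mul (Continuous.mul (continuous_const.mul ?_) (by fun_prop)) ?_
  · exact Continuous.rpow_const (by fun_prop) fun p => Or.inl (Real.exp_ne_zero _)
  · exact Continuous.rpow_const (by fun_prop) fun p => Or.inr hb

/-- The factor `y` of `G` absorbs the singularity of the derivative of `y ^ b` at `y = 0`. -/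
theorem contDiffOn_coefG (hΓ : ContDiffOn ℝ 1 (Function.uncurry Γ) (Ioi 0 ×ˢ Ici 0))
    (hb : 0 ≤ b) (hs : s ⊆ {p | p.2 ≤ 1}) (h0 : ∀ p ∈ s, inLV Γ p ≠ 0) :
    ContDiffOn ℝ 1 (coefG Γ κ a b K) s := by
  have hexp : ContDiff ℝ 1 (fun p : ℝ × ℝ => Real.exp p.1) := by fun_prop
  have hx : ContDiff ℝ 1 (fun p : ℝ × ℝ =>
      4 * Real.pi / 3 * K ^ 2 * κ⁻¹ * Real.exp p.1 ^ a * Real.exp p.1 ^ 6) :=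
    (contDiff_const.mul (hexp.rpow_const_of_ne fun p => Real.exp_ne_zero _)).mul (hexp.pow 6)
  have hy : ContDiff ℝ 1 (fun p : ℝ × ℝ => (1 - p.2) ^ (1 + b)) :=
    (Real.contDiff_rpow_const_of_le (n := 1) (by push_cast; linarith)).comp
      (contDiff_const.sub contDiff_snd)
  refine ((hx.mul hy).contDiffOn.div (contDiffOn_inLV hΓ hs) h0).congr fun p hp => ?_
  have : (1 - p.2) ^ (1 + b) = (1 - p.2) * (1 - p.2) ^ b :=
    Real.rpow_one_add' (sub_nonneg.2 (hs hp)) (by linarith)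
  simp only [coefG₁, timesY, Pi.div_apply, this]
  ring

end Coefficients

section HyperbolicLaw

theorem isOpen_openQuadrant : IsOpen openQuadrant :=
  isOpen_Ioi.prod isOpen_Ioi

theorem hasDerivAt_comp₂ {P : ℝ → ℝ → ℝ} {X Y : ℝ → ℝ} {x' y' r : ℝ}
    (hP : DifferentiableAt ℝ (Function.uncurry P) (X r, Y r)) (hX : HasDerivAt X x' r)
    (hY : HasDerivAt Y y' r) :
    HasDerivAt (fun r => P (X r) (Y r)) (d1 P (X r) (Y r) * x' + d2 P (X r) (Y r) * y') r := by
  have hF := hP.hasFDerivAt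
  set F := fderiv ℝ (Function.uncurry P) (X r, Y r)
  have h1 : d1 P (X r) (Y r) = F (1, 0) :=
    (hF.comp_hasDerivAt (f := fun u => (u, Y r)) (X r)
      ((hasDerivAt_id (X r)).prodMk (hasDerivAt_const (X r) (Y r)))).deriv
  have h2 : d2 P (X r) (Y r) = F (0, 1) :=
    (hF.comp_hasDerivAt (f := fun u => (X r, u)) (Y r)
      ((hasDerivAt_const (Y r) (X r)).prodMk (hasDerivAt_id (Y r)))).deriv
  have hxy : (x', y') = x' • ((1 : ℝ), (0 : ℝ)) + y' • ((0 : ℝ), (1 : ℝ)) := by simp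
  refine (hF.comp_hasDerivAt r (hX.prodMk hY)).congr_deriv ?_
  rw [hxy, map_add, map_smul, map_smul, h1, h2, smul_eq_mul, smul_eq_mul]
  ring

theorem d2_inXY (h : ℝ → ℝ → ℝ) (x y : ℝ) :
    d2 (inXY h) x y = x ^ 3 * d1 h (x ^ 3 * y) (x ^ 3) :=
  deriv_comp_mul_left (x ^ 3) (fun u => h u (x ^ 3)) y

theorem theta_mul {Prad Ptan : ℝ → ℝ → ℝ} (heq : EqualCentralPressures Prad Ptan) {x : ℝ}
    (hx : 0 < x) (y : ℝ) : Theta Prad Ptan x y * (1 - y) = Ptan x y - Prad x y := by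
  unfold Theta
  split_ifs with h
  · rw [h, sub_self, mul_zero, heq x hx, sub_self]
  · exact div_mul_cancel₀ _ (sub_ne_zero.2 (Ne.symm h))

/-- A law for which the structure equations have regular coefficients wherever `x < X_♭`, up to
vanishing density `y = 0`. No condition is imposed as `x → 0⁺`, or on the linearization at the
reference configuration beyond the choice of a factor `κ > 0`. -/
structure HyperbolicLaw (hrad htan : ℝ → ℝ → ℝ) (κ a b : ℝ) (Γ Υ : ℝ → ℝ → ℝ)
    (Xflat Xsharp : EReal) : Prop where
  rad_C1 : ContDiffOn ℝ 1 (Function.uncurry (inXY hrad)) openQuadrant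
  tan_C1 : ContDiffOn ℝ 1 (Function.uncurry (inXY htan)) openQuadrant
  equal_center : EqualCentralPressures (inXY hrad) (inXY htan)
  factor_pos : 0 < κ
  b_nonneg : 0 ≤ b
  gamma_eq : ∀ x y : ℝ, 0 < x → 0 < y → Γ x y = κ⁻¹ * x ^ a * y ^ b * d2 (inXY hrad) x y
  upsilon_eq : ∀ x y : ℝ, 0 < x → 0 < y →
    Υ x y = κ⁻¹ * x ^ a * y ^ (b - 1) *
      (x * d1 (inXY hrad) x y + 2 * Theta (inXY hrad) (inXY htan) x y)
  gamma_C1 : ContDiffOn ℝ 1 (Function.uncurry Γ) (Ioi 0 ×ˢ Ici 0)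
  upsilon_C1 : ContDiffOn ℝ 1 (Function.uncurry Υ) (Ioi 0 ×ˢ Ici 0)
  gamma_pos : ∀ x y : ℝ, 0 < x → (x : EReal) < Xflat → 0 ≤ y → y < 1 → 0 < Γ x y
  central : CentralHyperbolicity Γ Υ Xflat
  tangential : TangentialPositivity (inXY hrad) (inXY htan) Xsharp
  signs : RadialPressureSigns (inXY hrad) (min Xflat Xsharp)

theorem ConstitutiveAssumptions.hyperbolicLaw {hrad htan : ℝ → ℝ → ℝ} {lam mu a b c : ℝ}
    {Γ Υ : ℝ → ℝ → ℝ} {Xflat Xsharp : EReal}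
    (hyp : ConstitutiveAssumptions hrad htan lam mu a b c Γ Υ Xflat Xsharp) :
    HyperbolicLaw hrad htan (lam + 2 * mu) a b Γ Υ Xflat Xsharp where
  rad_C1 := hyp.rad_C2.of_le one_le_two
  tan_C1 := hyp.tan_C2.of_le one_le_two
  equal_center := hyp.equal_center
  factor_pos := hyp.linear.elliptic
  b_nonneg := hyp.b_pos.le
  gamma_eq := hyp.power_law.gamma_eq
  upsilon_eq x y hx hy := by rw [hyp.power_law.upsilon_eq x y hx hy, hyp.c_zero, add_zero]
  gamma_C1 := hyp.global.gamma_C1.mono (prod_mono_left Ioi_subset_Ici_self)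
  upsilon_C1 := hyp.global.upsilon_C1.mono (prod_mono_left Ioi_subset_Ici_self)
  gamma_pos x y hx := hyp.global.gamma_pos x y hx.le
  central := hyp.central
  tangential := hyp.tangential
  signs := hyp.signs

namespace HyperbolicLaw

variable {hrad htan : ℝ → ℝ → ℝ} {κ a b K l₀ : ℝ} {Γ Υ : ℝ → ℝ → ℝ} {Xflat Xsharp : EReal}
  {p : ℝ × ℝ}

theorem inLV_gamma_pos (law : HyperbolicLaw hrad htan κ a b Γ Υ Xflat Xsharp)
    (hX : (Real.exp l₀ : EReal) < Xflat) (h1 : p.1 ≤ l₀) (h2 : p.2 ∈ Icc (0 : ℝ) 1) :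
    0 < inLV Γ p := by
  have hx : (Real.exp p.1 : EReal) < Xflat :=
    lt_of_le_of_lt (EReal.coe_le_coe_iff.2 (Real.exp_le_exp.2 h1)) hX
  unfold inLV
  rcases h2.1.eq_or_lt with h | h
  · rw [← h, sub_zero]
    exact law.central.gamma_pos _ (Real.exp_pos _) hx
  · exact law.gamma_pos _ _ (Real.exp_pos _) hx (sub_nonneg.2 h2.2) (sub_lt_self 1 h)

theorem continuationHyp (law : HyperbolicLaw hrad htan κ a b Γ Υ Xflat Xsharp) (hK : 0 < K)
    (hX : (Real.exp l₀ : EReal) < Xflat) :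
    ContinuationHyp (coefB₁ Γ Υ) (coefG₁ Γ κ a b K) l₀ := by
  have hpos : ∀ p ∈ rect l₀, 0 < inLV Γ p := fun p hp => law.inLV_gamma_pos hX hp.1.2 hp.2
  have hne : ∀ p ∈ rect l₀, inLV Γ p ≠ 0 := fun p hp => (hpos p hp).ne'
  have hsub : rect l₀ ⊆ {p | p.2 ≤ 1} := fun p hp => hp.2.2
  refine ⟨contDiffOn_coefB₁ law.gamma_C1 law.upsilon_C1 hsub hne,
    contDiffOn_coefG law.gamma_C1 law.b_nonneg hsub hne,
    continuousOn_coefG₁ law.gamma_C1 law.b_nonneg hsub hne, fun p hp hp1 => ?_⟩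
  have := hpos p hp
  have := law.factor_pos
  have : 0 < 1 - p.2 := sub_pos.2 hp1
  unfold coefG₁
  positivity

theorem contDiffOn_coefB (law : HyperbolicLaw hrad htan κ a b Γ Υ Xflat Xsharp) :
    ContDiffOn ℝ 1 (coefB Γ Υ) (regularDomain Γ) :=
  ElasticBall.contDiffOn_coefB law.gamma_C1 law.upsilon_C1 (fun _ hp => hp.1.le)
    fun _ hp => hp.2.ne'

theorem contDiffOn_coefG (law : HyperbolicLaw hrad htan κ a b Γ Υ Xflat Xsharp) :
    ContDiffOn ℝ 1 (coefG Γ κ a b K) (regularDomain Γ) :=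
  ElasticBall.contDiffOn_coefG law.gamma_C1 law.b_nonneg (fun _ hp => hp.1.le)
    fun _ hp => hp.2.ne'

theorem center_mem_regularDomain (law : HyperbolicLaw hrad htan κ a b Γ Υ Xflat Xsharp)
    (hX : (Real.exp l₀ : EReal) < Xflat) : (l₀, 0) ∈ regularDomain Γ :=
  ⟨one_pos, law.inLV_gamma_pos hX le_rfl ⟨le_rfl, zero_le_one⟩⟩

theorem coefB_center_pos (law : HyperbolicLaw hrad htan κ a b Γ Υ Xflat Xsharp)
    (hX : (Real.exp l₀ : EReal) < Xflat) : 0 < coefB Γ Υ (l₀, 0) := by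
  have hΓ := law.central.gamma_pos _ (Real.exp_pos l₀) hX
  have hΥ := law.central.upsilon_pos _ (Real.exp_pos l₀) hX
  simp only [timesY, coefB₁, inLV, sub_zero, one_mul]
  positivity

theorem exists_isStructureCurve (law : HyperbolicLaw hrad htan κ a b Γ Υ Xflat Xsharp)
    (hK : 0 < K) (hl₀ : 0 < l₀) (hX : (Real.exp l₀ : EReal) < Xflat) :
    ∃ e u, IsStructureCurve (coefB Γ Υ) (coefG Γ κ a b K) l₀ e u := by
  have hyp := law.continuationHyp hK hX
  have hnhds : regularDomain Γ ∈ 𝓝 (l₀, (0 : ℝ)) :=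
    (isOpen_regularDomain law.gamma_C1).mem_nhds (law.center_mem_regularDomain hX)
  refine hyp.exists_isStructureCurve hl₀ (law.contDiffOn_coefB.contDiffAt hnhds)
    (law.contDiffOn_coefG.contDiffAt hnhds) (law.coefB_center_pos hX).le ?_
  have := hyp.G₁_pos (l₀, 0) ⟨⟨hl₀.le, le_rfl⟩, le_rfl, zero_le_one⟩ one_pos
  simpa only [timesY, sub_zero, one_mul] using this

theorem d2_prad_ne_zero (law : HyperbolicLaw hrad htan κ a b Γ Υ Xflat Xsharp)
    (hp : p ∈ regularDomain Γ) : inLV (d2 (inXY hrad)) p ≠ 0 := fun h0 => by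
  refine hp.2.ne' ?_
  unfold inLV at h0 ⊢
  rw [law.gamma_eq _ _ (Real.exp_pos _) (sub_pos.2 hp.1), h0, mul_zero]

theorem coefB_eq (law : HyperbolicLaw hrad htan κ a b Γ Υ Xflat Xsharp)
    (hp : p ∈ regularDomain Γ) :
    coefB Γ Υ p = (Real.exp p.1 * inLV (d1 (inXY hrad)) p +
      2 * inLV (Theta (inXY hrad) (inXY htan)) p) / inLV (d2 (inXY hrad)) p := by
  have hκ := law.factor_pos
  have hx := Real.exp_pos p.1
  have hy : 0 < 1 - p.2 := sub_pos.2 hp.1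
  have hD := law.d2_prad_ne_zero hp
  simp only [timesY, coefB₁, inLV] at hD ⊢
  rw [law.gamma_eq _ _ hx hy, law.upsilon_eq _ _ hx hy, Real.rpow_sub_one hy.ne']
  field_simp

theorem coefG_eq (law : HyperbolicLaw hrad htan κ a b Γ Υ Xflat Xsharp)
    (hp : p ∈ regularDomain Γ) :
    coefG Γ κ a b K p =
      4 * Real.pi / 3 * K ^ 2 * Real.exp p.1 ^ 6 * (1 - p.2) / inLV (d2 (inXY hrad)) p := by
  have hκ := law.factor_pos
  have hx := Real.exp_pos p.1
  have hy : 0 < 1 - p.2 := sub_pos.2 hp.1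
  have hD := law.d2_prad_ne_zero hp
  simp only [timesY, coefG₁, inLV] at hD ⊢
  rw [law.gamma_eq _ _ hx hy]
  field_simp

/-- Hydrostatic equilibrium, with `ρ = K x³ y` and `m = 4π/3 K x³ r³`, is the second structure
equation. -/
theorem equilibrium_iff (law : HyperbolicLaw hrad htan κ a b Γ Υ Xflat Xsharp) {r v' : ℝ}
    (hr : r ≠ 0) (hp : p ∈ regularDomain Γ) :
    inLV (d1 (inXY hrad)) p * (Real.exp p.1 * (-p.2 / r)) + inLV (d2 (inXY hrad)) p * -v' =
      -(2 / r) * (inLV (inXY hrad) p - inLV (inXY htan) p) -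
        K * (Real.exp p.1 ^ 3 * (1 - p.2)) *
          (4 * Real.pi / 3 * K * Real.exp p.1 ^ 3 * r ^ 3 / r ^ 2) ↔
    v' = (structureField (coefB Γ Υ) (coefG Γ κ a b K) r p).2 := by
  have hD := law.d2_prad_ne_zero hp
  have hΘ : inLV (inXY hrad) p - inLV (inXY htan) p =
      -(inLV (Theta (inXY hrad) (inXY htan)) p * p.2) := by
    have := theta_mul law.equal_center (Real.exp_pos p.1) (1 - p.2)
    rw [sub_sub_cancel] at this
    simp only [inLV, this]
    ring
  rw [hΘ, structureField, law.coefB_eq hp, law.coefG_eq hp]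
  field_simp
  constructor <;> intro h <;> linarith

end HyperbolicLaw

end HyperbolicLaw

section BallCurve

/-- `η`, continuously extended to the center by `δ(0)`; the division in `eta` gives `0` there. -/
def centralEta (K : ℝ) (ρ : ℝ → ℝ) : ℝ → ℝ :=
  Function.update (eta K ρ) 0 (delta K ρ 0)

/-- The curve `(ℓ, v) = (log x, 1 - y)` of a density, where `x = η^{1/3}` and `y = δ/η`. -/
def ballCurve (K : ℝ) (ρ : ℝ → ℝ) (r : ℝ) : ℝ × ℝ :=
  (Real.log (centralEta K ρ r) / 3, 1 - delta K ρ r / centralEta K ρ r)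

variable {hrad htan h : ℝ → ℝ → ℝ} {K R R' r : ℝ} {ρ ρ' prad ptan prad' ptan' : ℝ → ℝ}

theorem centralEta_zero : centralEta K ρ 0 = delta K ρ 0 :=
  Function.update_self ..

theorem centralEta_of_pos (hr : 0 < r) : centralEta K ρ r = eta K ρ r :=
  Function.update_of_ne hr.ne' ..

theorem mass_eq_eta (hK : 0 < K) (hr : 0 < r) :
    mass ρ r = 4 * Real.pi / 3 * (K * eta K ρ r) * r ^ 3 := by
  have := Real.pi_pos
  unfold eta
  field_simp

theorem centralEta_eq_radialMean (hR : 0 < R) (hr : r ∈ Icc 0 R) :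
    centralEta K ρ r =
      3 / K * radialMean 2 (IccExtend hR.le ((Icc 0 R).domRestrict ρ)) r := by
  set σ : ℝ → ℝ := IccExtend hR.le ((Icc 0 R).domRestrict ρ) with hσ
  have hσρ : EqOn σ ρ (Icc 0 R) := fun s hs => by rw [hσ, IccExtend_of_mem _ _ hs]; rfl
  rcases hr.1.eq_or_lt with rfl | hr0
  · rw [centralEta_zero, radialMean_zero, hσρ hr, delta, smul_eq_mul]
    norm_num
    ring
  · have hint : ∫ s in (0 : ℝ)..r, ρ s * s ^ 2 = r ^ 3 * radialMean 2 σ r := by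
      rw [← smul_eq_mul, pow_smul_radialMean]
      refine intervalIntegral.integral_congr fun s hs => ?_
      rw [uIcc_of_le hr.1] at hs
      simp only [hσρ ⟨hs.1, hs.2.trans hr.2⟩, smul_eq_mul, mul_comm]
    have := Real.pi_pos
    rw [centralEta_of_pos hr0, eta, mass, hint]
    field_simp

theorem continuousOn_centralEta (hR : 0 < R) (hρ : ContinuousOn ρ (Icc 0 R)) :
    ContinuousOn (centralEta K ρ) (Icc 0 R) := by
  have hσ : Continuous (IccExtend hR.le ((Icc 0 R).domRestrict ρ)) :=
    (continuousOn_iff_continuous_domRestrict.1 hρ).Icc_extend'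
  exact (continuous_const.mul (continuous_radialMean hσ)).continuousOn.congr fun _ hr =>
    centralEta_eq_radialMean hR hr

theorem hasDerivAt_centralEta (hρ : ContinuousOn ρ (Icc 0 R)) (hr : r ∈ Ioo 0 R) :
    HasDerivAt (centralEta K ρ) (3 * (delta K ρ r - centralEta K ρ r) / r) r := by
  have hR : 0 < R := hr.1.trans hr.2
  have hσ : Continuous (IccExtend hR.le ((Icc 0 R).domRestrict ρ)) :=
    (continuousOn_iff_continuous_domRestrict.1 hρ).Icc_extend'
  have hev : centralEta K ρ =ᶠ[𝓝 r]
      fun s => 3 / K * radialMean 2 (IccExtend hR.le ((Icc 0 R).domRestrict ρ)) s := by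
    filter_upwards [isOpen_Ioo.mem_nhds hr] with s hs using
      centralEta_eq_radialMean hR (Ioo_subset_Icc_self hs)
  refine (((hasDerivAt_radialMean hσ hr.1.ne').const_mul (3 / K)).congr_of_eventuallyEq
    hev).congr_deriv ?_
  rw [centralEta_eq_radialMean hR (Ioo_subset_Icc_self hr),
    IccExtend_of_mem _ _ (Ioo_subset_Icc_self hr), delta]
  simp only [domRestrict_apply, smul_eq_mul]
  push_cast
  field_simp
  ring

theorem exp_ballCurve_fst_pow (hη : 0 < centralEta K ρ r) :
    Real.exp (ballCurve K ρ r).1 ^ 3 = centralEta K ρ r := by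
  rw [ballCurve, ← Real.exp_nat_mul]
  push_cast
  rw [mul_div_cancel₀ _ three_ne_zero, Real.exp_log hη]

theorem centralEta_mul_one_sub (hη : 0 < centralEta K ρ r) :
    centralEta K ρ r * (1 - (ballCurve K ρ r).2) = delta K ρ r := by
  rw [ballCurve, sub_sub_cancel, mul_div_cancel₀ _ hη.ne']

theorem inLV_inXY_ballCurve (hη : 0 < centralEta K ρ r) :
    inLV (inXY h) (ballCurve K ρ r) = h (delta K ρ r) (centralEta K ρ r) := by
  rw [inLV, inXY, exp_ballCurve_fst_pow hη, centralEta_mul_one_sub hη]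

theorem ballCurve_zero {l₀ : ℝ} (hK : 0 < K) (h0 : ρ 0 = K * Real.exp l₀ ^ 3) :
    ballCurve K ρ 0 = (l₀, 0) := by
  have hδ : delta K ρ 0 = Real.exp l₀ ^ 3 := by rw [delta, h0, mul_div_cancel_left₀ _ hK.ne']
  rw [ballCurve, centralEta_zero, hδ, div_self (by positivity), sub_self, Real.log_pow,
    Real.log_exp]
  push_cast
  rw [mul_div_cancel_left₀ _ three_ne_zero]

theorem delta_congr_of_ballCurve_eq (hη : 0 < centralEta K ρ r) (hη' : 0 < centralEta K ρ' r)
    (hu : ballCurve K ρ r = ballCurve K ρ' r) : delta K ρ r = delta K ρ' r := by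
  rw [← centralEta_mul_one_sub hη, ← centralEta_mul_one_sub hη', ← exp_ballCurve_fst_pow hη,
    ← exp_ballCurve_fst_pow hη', hu]

namespace IsRegularBall

theorem rho_pos (ball : IsRegularBall R ρ prad ptan) (hr : r ∈ Ioo 0 R) : 0 < ρ r := by
  rw [← ball.support] at hr
  exact (interior_subset hr).2

theorem eta_pos (ball : IsRegularBall R ρ prad ptan) (hK : 0 < K) (hr : r ∈ Ioc 0 R) :
    0 < eta K ρ r := by
  have hint : IntervalIntegrable (fun s => ρ s * s ^ 2) volume 0 r := by
    refine ContinuousOn.intervalIntegrable ?_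
    rw [uIcc_of_le hr.1.le]
    exact (ball.regular_rho.1.mono (Icc_subset_Icc_right hr.2)).mul (by fun_prop)
  have hpos : 0 < ∫ s in (0 : ℝ)..r, ρ s * s ^ 2 :=
    intervalIntegral.intervalIntegral_pos_of_pos_on hint (fun s hs =>
      mul_pos (ball.rho_pos ⟨hs.1, hs.2.trans_le hr.2⟩) (pow_pos hs.1 2)) hr.1
  have := Real.pi_pos
  have := hr.1
  unfold eta mass
  positivity

theorem centralEta_pos (ball : IsRegularBall R ρ prad ptan) (hK : 0 < K) (h0 : 0 < ρ 0)
    (hr : r ∈ Icc 0 R) : 0 < centralEta K ρ r := by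
  rcases hr.1.eq_or_lt with rfl | hr0
  · rw [centralEta_zero]
    exact div_pos h0 hK
  · rw [centralEta_of_pos hr0]
    exact ball.eta_pos hK ⟨hr0, hr.2⟩

theorem continuousOn_ballCurve (ball : IsRegularBall R ρ prad ptan) (hK : 0 < K) (h0 : 0 < ρ 0) :
    ContinuousOn (ballCurve K ρ) (Icc 0 R) := by
  have hη := continuousOn_centralEta (K := K) ball.radius_pos ball.regular_rho.1
  have hne : ∀ r ∈ Icc 0 R, centralEta K ρ r ≠ 0 := fun r hr => (ball.centralEta_pos hK h0 hr).ne'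
  exact ((hη.log hne).div_const 3).prodMk
    (continuousOn_const.sub ((ball.regular_rho.1.div_const K).div hη hne))

theorem hasDerivAt_ballCurve_fst (ball : IsRegularBall R ρ prad ptan) (hK : 0 < K)
    (hr : r ∈ Ioo 0 R) :
    HasDerivAt (fun s => (ballCurve K ρ s).1) (-(ballCurve K ρ r).2 / r) r := by
  have hη : 0 < centralEta K ρ r := by
    rw [centralEta_of_pos hr.1]
    exact ball.eta_pos hK (Ioo_subset_Ioc_self hr)
  refine (((hasDerivAt_centralEta ball.regular_rho.1 hr).log hη.ne').div_const 3).congr_deriv ?_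
  rw [ballCurve]
  field_simp
  ring

theorem differentiableAt_ballCurve_snd (ball : IsRegularBall R ρ prad ptan) (hK : 0 < K)
    (hr : r ∈ Ioo 0 R) : DifferentiableAt ℝ (fun s => (ballCurve K ρ s).2) r := by
  have hη : centralEta K ρ r ≠ 0 := by
    rw [centralEta_of_pos hr.1]
    exact (ball.eta_pos hK (Ioo_subset_Ioc_self hr)).ne'
  have hρ : DifferentiableAt ℝ ρ r :=
    (ball.regular_rho.2.differentiableOn one_ne_zero).differentiableAt (Ioc_mem_nhds hr.1 hr.2)
  exact ((hρ.div_const K).div (hasDerivAt_centralEta ball.regular_rho.1 hr).differentiableAt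
    hη).const_sub 1

theorem radius_eq (ball : IsRegularBall R ρ prad ptan) (ball' : IsRegularBall R' ρ' prad' ptan')
    (hp : EqOn prad prad' (Icc 0 (min R R'))) : R = R' := by
  have hmem : min R R' ∈ Icc 0 (min R R') :=
    ⟨(lt_min ball.radius_pos ball'.radius_pos).le, le_rfl⟩
  have heq := hp hmem
  rcases lt_trichotomy R R' with h | h | h
  · rw [min_eq_left h.le, ball.prad_boundary] at heq
    exact absurd heq (ball'.prad_pos R ⟨ball.radius_pos.le, h⟩).ne
  · exact h
  · rw [min_eq_right h.le, ball'.prad_boundary] at heq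
    exact absurd heq (ball.prad_pos R' ⟨ball'.radius_pos.le, h⟩).ne'

end IsRegularBall

namespace IsRegularElasticBall

theorem prad_eq_inLV (ball : IsRegularElasticBall hrad htan K R ρ prad ptan) (hK : 0 < K)
    (hr : r ∈ Ioc 0 R) : prad r = inLV (inXY hrad) (ballCurve K ρ r) := by
  have hη := centralEta_of_pos (K := K) (ρ := ρ) hr.1
  rw [inLV_inXY_ballCurve (hη ▸ ball.eta_pos hK hr), ball.eos_rad r hr, hη]

theorem ptan_eq_inLV (ball : IsRegularElasticBall hrad htan K R ρ prad ptan) (hK : 0 < K)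
    (hr : r ∈ Ioc 0 R) : ptan r = inLV (inXY htan) (ballCurve K ρ r) := by
  have hη := centralEta_of_pos (K := K) (ρ := ρ) hr.1
  rw [inLV_inXY_ballCurve (hη ▸ ball.eta_pos hK hr), ball.eos_tan r hr, hη]

theorem eq_of_eqOn_ballCurve (ball : IsRegularElasticBall hrad htan K R ρ prad ptan)
    (ball' : IsRegularElasticBall hrad htan K R' ρ' prad' ptan') (hK : 0 < K) (h0 : ρ 0 = ρ' 0)
    (hu : EqOn (ballCurve K ρ) (ballCurve K ρ') (Icc 0 (min R R'))) :
    R = R' ∧ EqOn ρ ρ' (Ici 0) ∧ EqOn prad prad' (Ici 0) ∧ EqOn ptan ptan' (Ici 0) := by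
  set s := min R R'
  have hs0 : 0 < s := lt_min ball.radius_pos ball'.radius_pos
  have hsub : Icc 0 s ⊆ Icc 0 R := Icc_subset_Icc_right (min_le_left _ _)
  have hsub' : Icc 0 s ⊆ Icc 0 R' := Icc_subset_Icc_right (min_le_right _ _)
  have hIoc : Ioc 0 s ⊆ Ioc 0 R := Ioc_subset_Ioc_right (min_le_left _ _)
  have hIoc' : Ioc 0 s ⊆ Ioc 0 R' := Ioc_subset_Ioc_right (min_le_right _ _)
  have hclosure : Icc 0 s ⊆ closure (Ioc 0 s) := (closure_Ioc hs0.ne).ge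
  have hprad : EqOn prad prad' (Icc 0 s) := by
    refine EqOn.of_subset_closure (fun r hr => ?_) (ball.regular_prad.1.mono hsub)
      (ball'.regular_prad.1.mono hsub') Ioc_subset_Icc_self hclosure
    rw [ball.prad_eq_inLV hK (hIoc hr), ball'.prad_eq_inLV hK (hIoc' hr),
      hu (Ioc_subset_Icc_self hr)]
  have hptan : EqOn ptan ptan' (Icc 0 s) := by
    refine EqOn.of_subset_closure (fun r hr => ?_) (ball.regular_ptan.1.mono hsub)
      (ball'.regular_ptan.1.mono hsub') Ioc_subset_Icc_self hclosure
    rw [ball.ptan_eq_inLV hK (hIoc hr), ball'.ptan_eq_inLV hK (hIoc' hr),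
      hu (Ioc_subset_Icc_self hr)]
  have hρ : EqOn ρ ρ' (Icc 0 s) := fun r hr => by
    rcases hr.1.eq_or_lt with rfl | hr0
    · exact h0
    have hη := centralEta_of_pos (K := K) (ρ := ρ) hr0 ▸ ball.eta_pos hK (hIoc ⟨hr0, hr.2⟩)
    have hη' := centralEta_of_pos (K := K) (ρ := ρ') hr0 ▸ ball'.eta_pos hK (hIoc' ⟨hr0, hr.2⟩)
    exact (div_left_inj' hK.ne').1 (delta_congr_of_ballCurve_eq hη hη' (hu hr))
  obtain rfl : R = R' := ball.toIsRegularBall.radius_eq ball'.toIsRegularBall hprad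
  have hs : s = R := min_self R
  have extend {f g : ℝ → ℝ} (hfg : EqOn f g (Icc 0 s)) (hvac : ∀ r, R < r → f r = g r) :
      EqOn f g (Ici 0) := fun r hr =>
    (le_or_gt r R).elim (fun h => hfg ⟨hr, hs ▸ h⟩) (hvac r)
  exact ⟨rfl,
    extend hρ fun r hr => (ball.vacuum r hr).1.trans (ball'.vacuum r hr).1.symm,
    extend hprad fun r hr => (ball.vacuum r hr).2.1.trans (ball'.vacuum r hr).2.1.symm,
    extend hptan fun r hr => (ball.vacuum r hr).2.2.trans (ball'.vacuum r hr).2.2.symm⟩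

end IsRegularElasticBall

theorem hasDerivAt_inLV_comp {P : ℝ → ℝ → ℝ}
    (hP : ContDiffOn ℝ 1 (Function.uncurry P) openQuadrant)
    {u : ℝ → ℝ × ℝ} {l' v' : ℝ} (hl : HasDerivAt (fun s => (u s).1) l' r)
    (hv : HasDerivAt (fun s => (u s).2) v' r) (hlt : (u r).2 < 1) :
    HasDerivAt (fun s => inLV P (u s))
      (inLV (d1 P) (u r) * (Real.exp (u r).1 * l') + inLV (d2 P) (u r) * -v') r := by
  have hmem : (Real.exp (u r).1, 1 - (u r).2) ∈ openQuadrant :=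
    ⟨Real.exp_pos _, sub_pos.2 hlt⟩
  exact hasDerivAt_comp₂ ((hP.differentiableOn one_ne_zero).differentiableAt
    (isOpen_openQuadrant.mem_nhds hmem)) hl.exp (hv.const_sub 1)

namespace HyperbolicLaw

variable {κ a b l₀ : ℝ} {Γ Υ : ℝ → ℝ → ℝ} {Xflat Xsharp : EReal}

theorem solvesAt_ballCurve (law : HyperbolicLaw hrad htan κ a b Γ Υ Xflat Xsharp) (hK : 0 < K)
    (ball : IsRegularElasticBall hrad htan K R ρ prad ptan) (hr : r ∈ Ioo 0 R)
    (hreg : ballCurve K ρ r ∈ regularDomain Γ) :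
    SolvesAt (coefB Γ Υ) (coefG Γ κ a b K) (ballCurve K ρ) r := by
  have hl := ball.hasDerivAt_ballCurve_fst hK hr
  have hv := (ball.differentiableAt_ballCurve_snd hK hr).hasDerivAt
  have hη := ball.eta_pos hK (Ioo_subset_Ioc_self hr)
  rw [← centralEta_of_pos hr.1] at hη
  obtain ⟨Φ, hΦ⟩ := ball.equilibrium
  obtain ⟨hpot, hprad⟩ := hΦ r hr
  have hev : prad =ᶠ[𝓝 r] fun s => inLV (inXY hrad) (ballCurve K ρ s) := by
    filter_upwards [isOpen_Ioo.mem_nhds hr] with s hs using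
      ball.prad_eq_inLV hK (Ioo_subset_Ioc_self hs)
  have heq := (hasDerivAt_inLV_comp law.rad_C1 hl hv hreg.1).unique
    (hprad.congr_of_eventuallyEq hev.symm)
  have hρ : ρ r = K * (Real.exp (ballCurve K ρ r).1 ^ 3 * (1 - (ballCurve K ρ r).2)) := by
    rw [exp_ballCurve_fst_pow hη, centralEta_mul_one_sub hη, delta, mul_div_cancel₀ _ hK.ne']
  have hm : mass ρ r = 4 * Real.pi / 3 * K * Real.exp (ballCurve K ρ r).1 ^ 3 * r ^ 3 := by
    rw [exp_ballCurve_fst_pow hη, mass_eq_eta hK hr.1, centralEta_of_pos hr.1, mul_assoc _ K]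
  rw [hpot.deriv, hρ, hm, ball.prad_eq_inLV hK (Ioo_subset_Ioc_self hr),
    ball.ptan_eq_inLV hK (Ioo_subset_Ioc_self hr), law.equilibrium_iff hr.1.ne' hreg] at heq
  exact hl.prodMk (hv.congr_deriv heq)

theorem ball_unique (law : HyperbolicLaw hrad htan κ a b Γ Υ Xflat Xsharp) (hK : 0 < K)
    (hX : (Real.exp l₀ : EReal) < Xflat)
    (ball : IsRegularElasticBall hrad htan K R ρ prad ptan) (h0 : ρ 0 = K * Real.exp l₀ ^ 3)
    (hreg : ∀ r ∈ Ioo 0 R, ballCurve K ρ r ∈ regularDomain Γ)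
    (ball' : IsRegularElasticBall hrad htan K R' ρ' prad' ptan')
    (h0' : ρ' 0 = K * Real.exp l₀ ^ 3) :
    R = R' ∧ EqOn ρ ρ' (Ici 0) ∧ EqOn prad prad' (Ici 0) ∧ EqOn ptan ptan' (Ici 0) := by
  have hρ0 : 0 < K * Real.exp l₀ ^ 3 := by positivity
  refine ball.eq_of_eqOn_ballCurve ball' hK (h0.trans h0'.symm) ?_
  have hIoo : Ioo 0 (min R R') ⊆ Ioo 0 R := Ioo_subset_Ioo_right (min_le_left _ _)
  have hIoo' : Ioo 0 (min R R') ⊆ Ioo 0 R' := Ioo_subset_Ioo_right (min_le_right _ _)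
  exact eqOn_of_solvesAt (isOpen_regularDomain law.gamma_C1) law.contDiffOn_coefB
    (law.contDiffOn_coefG (K := K)) (law.center_mem_regularDomain hX) (law.coefB_center_pos hX)
    (lt_min ball.radius_pos ball'.radius_pos)
    ((ball.continuousOn_ballCurve hK (h0 ▸ hρ0)).mono (Icc_subset_Icc_right (min_le_left _ _)))
    ((ball'.continuousOn_ballCurve hK (h0' ▸ hρ0)).mono (Icc_subset_Icc_right (min_le_right _ _)))
    (ballCurve_zero hK h0) (ballCurve_zero hK h0')
    (fun r hr => ⟨hreg r (hIoo hr), law.solvesAt_ballCurve hK ball (hIoo hr) (hreg r (hIoo hr))⟩)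
    fun r hr => law.solvesAt_ballCurve hK ball' (hIoo' hr)

end HyperbolicLaw

end BallCurve

section Existence

/-- The density `K x³ y` along a curve in the variables `ℓ = log x`, `v = 1 - y`. -/
def curveDensity (K : ℝ) (u : ℝ → ℝ × ℝ) (r : ℝ) : ℝ :=
  K * (Real.exp (u r).1 ^ 3 * (1 - (u r).2))

theorem exists_hasDerivAt_of_continuousOn_Ioo {f : ℝ → ℝ} {a b : ℝ}
    (hf : ContinuousOn f (Ioo a b)) : ∃ F : ℝ → ℝ, ∀ x ∈ Ioo a b, HasDerivAt F (f x) x := by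
  rcases (Ioo a b).eq_empty_or_nonempty with h | ⟨c, hc⟩
  · simp [h]
  refine ⟨fun x => ∫ t in c..x, f t, fun x hx => ?_⟩
  have hint : IntervalIntegrable f volume c x :=
    (hf.mono (ordConnected_Ioo.uIcc_subset hc hx)).intervalIntegrable
  exact intervalIntegral.integral_hasDerivAt_right hint
    (hf.stronglyMeasurableAtFilter isOpen_Ioo x hx) (hf.continuousAt (isOpen_Ioo.mem_nhds hx))

theorem contDiffOn_one_of_hasDerivAt {E : Type*} [NormedAddCommGroup E] [NormedSpace ℝ E]
    {f f' : ℝ → E} {s : Set ℝ} (hs : IsOpen s) (hf : ∀ r ∈ s, HasDerivAt f (f' r) r)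
    (hf' : ContinuousOn f' s) : ContDiffOn ℝ 1 f s := by
  rw [← zero_add (1 : WithTop ℕ∞), contDiffOn_succ_iff_deriv_of_isOpen hs, contDiffOn_zero]
  exact ⟨fun r hr => (hf r hr).differentiableAt.differentiableWithinAt, by simp,
    hf'.congr fun r hr => (hf r hr).deriv⟩

variable {B G : ℝ × ℝ → ℝ} {K R e l₀ r : ℝ} {u : ℝ → ℝ × ℝ} {U : Set (ℝ × ℝ)}

theorem regularProfile_indicator {f : ℝ → ℝ} (hR : R < e) (hc : ContinuousOn f (Icc 0 e))
    (hd : ContDiffOn ℝ 1 f (Ioo 0 e)) : RegularProfile R ((Iic R).indicator f) :=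
  ⟨(hc.mono (Icc_subset_Icc_right hR.le)).congr fun _ hr => indicator_of_mem (mem_Iic.2 hr.2) f,
    (hd.mono fun _ hr => ⟨hr.1, hr.2.trans_lt hR⟩).congr
      fun _ hr => indicator_of_mem (mem_Iic.2 hr.2) f⟩

namespace IsStructureCurve

theorem snd_lt_one (hu : IsStructureCurve B G l₀ e u) (hr : r ∈ Icc 0 e) : (u r).2 < 1 := by
  rcases hr.1.eq_or_lt with rfl | hr0
  · rw [hu.center]
    exact one_pos
  · exact (hu.snd_mem r ⟨hr0, hr.2⟩).2

theorem contDiffOn (hu : IsStructureCurve B G l₀ e u) (hB : ContinuousOn B U)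
    (hG : ContinuousOn G U) (hU : MapsTo u (Ioo 0 e) U) : ContDiffOn ℝ 1 u (Ioo 0 e) := by
  refine contDiffOn_one_of_hasDerivAt isOpen_Ioo hu.solvesAt ?_
  have huc := hu.continuousOn.mono Ioo_subset_Icc_self
  have hne : ∀ r ∈ Ioo 0 e, r ≠ 0 := fun r hr => hr.1.ne'
  exact (huc.snd.neg.div continuousOn_id hne).prodMk
    ((((hB.comp huc hU).neg.mul huc.snd).add ((continuousOn_pow 2).mul (hG.comp huc hU))).div
      continuousOn_id hne)

theorem mass_curveDensity (hu : IsStructureCurve B G l₀ e u) (hR : R < e) (hr : r ∈ Icc 0 R) :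
    mass ((Iic R).indicator (curveDensity K u)) r =
      4 * Real.pi / 3 * K * Real.exp (u r).1 ^ 3 * r ^ 3 := by
  have huc : ContinuousOn u (Icc 0 r) :=
    hu.continuousOn.mono (Icc_subset_Icc_right (hr.2.trans hR.le))
  have hcongr : ∫ s in (0 : ℝ)..r, (Iic R).indicator (curveDensity K u) s * s ^ 2 =
      ∫ s in (0 : ℝ)..r, curveDensity K u s * s ^ 2 := by
    refine intervalIntegral.integral_congr fun s hs => ?_
    rw [uIcc_of_le hr.1] at hs
    simp only [indicator_of_mem (show s ∈ Iic R from hs.2.trans hr.2)]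
  have hint : ∫ s in (0 : ℝ)..r, curveDensity K u s * s ^ 2 =
      K / 3 * Real.exp (u r).1 ^ 3 * r ^ 3 - K / 3 * Real.exp (u 0).1 ^ 3 * 0 ^ 3 := by
    refine intervalIntegral.integral_eq_sub_of_hasDerivAt_of_le
      (f := fun r => K / 3 * Real.exp (u r).1 ^ 3 * r ^ 3) hr.1 (by fun_prop) (fun s hs => ?_) ?_
    · have hfst := (hu.solvesAt s ⟨hs.1, hs.2.trans_le (hr.2.trans hR.le)⟩).hasDerivAt_fst
      refine (((hfst.exp.fun_pow 3).const_mul (K / 3)).fun_mul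
        (hasDerivAt_pow 3 s)).congr_deriv ?_
      have := hs.1
      unfold curveDensity
      push_cast
      field_simp
      ring
    · refine ContinuousOn.intervalIntegrable ?_
      rw [uIcc_of_le hr.1]
      unfold curveDensity
      fun_prop
  rw [mass, hcongr, hint]
  ring

theorem eta_curveDensity (hu : IsStructureCurve B G l₀ e u) (hK : 0 < K) (hR : R < e)
    (hr : r ∈ Ioc 0 R) :
    eta K ((Iic R).indicator (curveDensity K u)) r = Real.exp (u r).1 ^ 3 := by
  have := Real.pi_pos
  have := hr.1
  rw [eta, hu.mass_curveDensity hR (Ioc_subset_Icc_self hr)]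
  field_simp

end IsStructureCurve

theorem delta_curveDensity (hK : 0 < K) (hr : r ≤ R) :
    delta K ((Iic R).indicator (curveDensity K u)) r =
      Real.exp (u r).1 ^ 3 * (1 - (u r).2) := by
  rw [delta, indicator_of_mem (mem_Iic.2 hr), curveDensity, mul_div_cancel_left₀ _ hK.ne']

namespace IsStructureCurve

theorem eqOn_ballCurve (hu : IsStructureCurve B G l₀ e u) (hK : 0 < K) (hR : R < e) :
    EqOn (ballCurve K ((Iic R).indicator (curveDensity K u))) u (Ioc 0 R) := fun r hr => by
  have hx : Real.exp (u r).1 ^ 3 ≠ 0 := by positivity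
  rw [ballCurve, centralEta_of_pos hr.1, hu.eta_curveDensity hK hR hr,
    delta_curveDensity hK hr.2, mul_div_cancel_left₀ _ hx, Real.log_pow, Real.log_exp,
    sub_sub_cancel]
  push_cast
  rw [mul_div_cancel_left₀ _ three_ne_zero]

theorem interior_support_curveDensity (hu : IsStructureCurve B G l₀ e u) (hK : 0 < K)
    (hR : R < e) :
    interior {r | 0 < r ∧ 0 < (Iic R).indicator (curveDensity K u) r} = Ioo 0 R := by
  have hset : {r | 0 < r ∧ 0 < (Iic R).indicator (curveDensity K u) r} = Ioc 0 R := by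
    ext r
    refine and_congr_right fun hr0 => ?_
    by_cases hr : r ≤ R
    · have : 0 < 1 - (u r).2 := sub_pos.2 (hu.snd_lt_one ⟨hr0.le, hr.trans hR.le⟩)
      rw [indicator_of_mem (mem_Iic.2 hr), curveDensity]
      exact iff_of_true (by positivity) hr
    · rw [indicator_of_notMem (mt mem_Iic.1 hr)]
      exact iff_of_false (lt_irrefl 0) hr
  rw [hset, interior_Ioc]

end IsStructureCurve

namespace HyperbolicLaw

variable {hrad htan : ℝ → ℝ → ℝ} {κ a b : ℝ} {Γ Υ : ℝ → ℝ → ℝ} {Xflat Xsharp : EReal}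
  {P : ℝ → ℝ → ℝ}

theorem mem_regularDomain (law : HyperbolicLaw hrad htan κ a b Γ Υ Xflat Xsharp)
    (hX : (Real.exp l₀ : EReal) < Xflat) {p : ℝ × ℝ} (hp : p ∈ Iio l₀ ×ˢ Ioo (0 : ℝ) 1) :
    p ∈ regularDomain Γ :=
  ⟨hp.2.2, law.inLV_gamma_pos hX (le_of_lt hp.1) (Ioo_subset_Icc_self hp.2)⟩

theorem regularProfile_inLV (law : HyperbolicLaw hrad htan κ a b Γ Υ Xflat Xsharp)
    (hu : IsStructureCurve (coefB Γ Υ) (coefG Γ κ a b K) l₀ e u)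
    (hX : (Real.exp l₀ : EReal) < Xflat) (hR : R < e)
    (hP : ContDiffOn ℝ 1 (Function.uncurry P) openQuadrant) :
    RegularProfile R ((Iic R).indicator fun r => inLV P (u r)) := by
  have hmaps : MapsTo (fun r => (Real.exp (u r).1, 1 - (u r).2)) (Icc 0 e) openQuadrant :=
    fun r hr => ⟨Real.exp_pos _, sub_pos.2 (hu.snd_lt_one hr)⟩
  have huc := hu.continuousOn
  have huC : ContDiffOn ℝ 1 u (Ioo 0 e) :=
    hu.contDiffOn law.contDiffOn_coefB.continuousOn law.contDiffOn_coefG.continuousOn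
      fun r hr => law.mem_regularDomain hX
        ⟨hu.fst_lt (Ioo_subset_Ioc_self hr), hu.snd_mem r (Ioo_subset_Ioc_self hr)⟩
  exact regularProfile_indicator hR
    (hP.continuousOn.comp (huc.fst.rexp.prodMk (continuousOn_const.sub huc.snd)) hmaps)
    (hP.comp (huC.fst.exp.prodMk (contDiffOn_const.sub huC.snd))
      (hmaps.mono_left Ioo_subset_Icc_self))

theorem regularProfile_curveDensity (law : HyperbolicLaw hrad htan κ a b Γ Υ Xflat Xsharp)
    (hu : IsStructureCurve (coefB Γ Υ) (coefG Γ κ a b K) l₀ e u)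
    (hX : (Real.exp l₀ : EReal) < Xflat) (hR : R < e) :
    RegularProfile R ((Iic R).indicator (curveDensity K u)) :=
  law.regularProfile_inLV (P := fun x y => K * (x ^ 3 * y)) hu hX hR <|
    contDiffOn_const.mul ((contDiffOn_fst.pow 3).mul contDiffOn_snd)

theorem equilibrium_curveDensity (law : HyperbolicLaw hrad htan κ a b Γ Υ Xflat Xsharp)
    (hu : IsStructureCurve (coefB Γ Υ) (coefG Γ κ a b K) l₀ e u)
    (hX : (Real.exp l₀ : EReal) < Xflat) (hR : R < e) :
    ∃ Φ : ℝ → ℝ, ∀ r ∈ Ioo 0 R,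
      HasDerivAt Φ (mass ((Iic R).indicator (curveDensity K u)) r / r ^ 2) r ∧
      HasDerivAt ((Iic R).indicator fun r => inLV (inXY hrad) (u r))
        (-(2 / r) * ((Iic R).indicator (fun r => inLV (inXY hrad) (u r)) r -
            (Iic R).indicator (fun r => inLV (inXY htan) (u r)) r) -
          (Iic R).indicator (curveDensity K u) r * deriv Φ r) r := by
  have huc : ContinuousOn u (Ioo 0 R) :=
    hu.continuousOn.mono fun r hr => ⟨hr.1.le, hr.2.le.trans hR.le⟩
  have hmass : ContinuousOn
      (fun r => mass ((Iic R).indicator (curveDensity K u)) r / r ^ 2) (Ioo 0 R) :=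
    ((by fun_prop : ContinuousOn
        (fun r => 4 * Real.pi / 3 * K * Real.exp (u r).1 ^ 3 * r ^ 3) (Ioo 0 R)).congr fun r hr =>
      hu.mass_curveDensity hR (Ioo_subset_Icc_self hr)).div (continuousOn_pow 2) fun r hr =>
        pow_ne_zero 2 hr.1.ne'
  obtain ⟨Φ, hΦ⟩ := exists_hasDerivAt_of_continuousOn_Ioo hmass
  refine ⟨Φ, fun r hr => ⟨hΦ r hr, ?_⟩⟩
  have hre : r ∈ Ioo 0 e := ⟨hr.1, hr.2.trans hR⟩
  have hmem : u r ∈ Iio l₀ ×ˢ Ioo (0 : ℝ) 1 :=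
    ⟨hu.fst_lt (Ioo_subset_Ioc_self hre), hu.snd_mem r (Ioo_subset_Ioc_self hre)⟩
  have hev : (Iic R).indicator (fun r => inLV (inXY hrad) (u r)) =ᶠ[𝓝 r]
      fun r => inLV (inXY hrad) (u r) := by
    filter_upwards [Iio_mem_nhds hr.2] with s hs using indicator_of_mem (mem_Iic.2 hs.le) _
  have hrR : r ∈ Iic R := hr.2.le
  rw [(hΦ r hr).deriv, hu.mass_curveDensity hR (Ioo_subset_Icc_self hr), indicator_of_mem hrR,
    indicator_of_mem hrR, indicator_of_mem hrR, curveDensity,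
    ← (law.equilibrium_iff hr.1.ne' (law.mem_regularDomain hX hmem)).2 rfl]
  exact (hasDerivAt_inLV_comp law.rad_C1 (hu.solvesAt r hre).hasDerivAt_fst
    (hu.solvesAt r hre).hasDerivAt_snd hmem.2.2).congr_of_eventuallyEq hev

theorem inLV_ptan_pos (law : HyperbolicLaw hrad htan κ a b Γ Υ Xflat Xsharp)
    (hu : IsStructureCurve B G l₀ e u) (hX : (Real.exp l₀ : EReal) < Xsharp) (hr : r ∈ Icc 0 e)
    (hp : 0 < inLV (inXY hrad) (u r)) : 0 < inLV (inXY htan) (u r) := by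
  rcases hr.1.eq_or_lt with rfl | hr0
  · simp only [hu.center, inLV, sub_zero] at hp ⊢
    rwa [← law.equal_center _ (Real.exp_pos l₀)]
  · have hv := hu.snd_mem r ⟨hr0, hr.2⟩
    have hx : (Real.exp (u r).1 : EReal) < Xsharp :=
      (EReal.coe_lt_coe_iff.2 (Real.exp_lt_exp.2 (hu.fst_lt ⟨hr0, hr.2⟩))).trans hX
    exact law.tangential.ptan_pos _ _ (Real.exp_pos _) hx (sub_pos.2 hv.2)
      (sub_lt_self 1 hv.1) hp.le

theorem isRegularElasticBall (law : HyperbolicLaw hrad htan κ a b Γ Υ Xflat Xsharp)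
    (hK : 0 < K) (hu : IsStructureCurve (coefB Γ Υ) (coefG Γ κ a b K) l₀ e u)
    (hX : (Real.exp l₀ : EReal) < min Xflat Xsharp) (hR : R ∈ Ioo 0 e)
    (hpos : ∀ r ∈ Ico 0 R, 0 < inLV (inXY hrad) (u r)) (hzero : inLV (inXY hrad) (u R) = 0) :
    IsRegularElasticBall hrad htan K R ((Iic R).indicator (curveDensity K u))
      ((Iic R).indicator fun r => inLV (inXY hrad) (u r))
      ((Iic R).indicator fun r => inLV (inXY htan) (u r)) where
  radius_pos := hR.1
  support := hu.interior_support_curveDensity hK hR.2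
  regular_rho := law.regularProfile_curveDensity hu (lt_min_iff.1 hX).1 hR.2
  regular_prad := law.regularProfile_inLV hu (lt_min_iff.1 hX).1 hR.2 law.rad_C1
  regular_ptan := law.regularProfile_inLV hu (lt_min_iff.1 hX).1 hR.2 law.tan_C1
  equilibrium := law.equilibrium_curveDensity hu (lt_min_iff.1 hX).1 hR.2
  prad_pos r hr := by
    rw [indicator_of_mem (mem_Iic.2 hr.2.le)]
    exact hpos r hr
  ptan_pos r hr := by
    rw [indicator_of_mem (mem_Iic.2 hr.2.le)]
    exact law.inLV_ptan_pos hu (lt_min_iff.1 hX).2 ⟨hr.1, (hr.2.trans hR.2).le⟩ (hpos r hr)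
  prad_boundary := by rw [indicator_of_mem self_mem_Iic, hzero]
  center := by
    rw [indicator_of_mem (mem_Iic.2 hR.1.le), indicator_of_mem (mem_Iic.2 hR.1.le), hu.center]
    simpa only [inLV, sub_zero] using law.equal_center _ (Real.exp_pos l₀)
  vacuum r hr := by
    have hr' : r ∉ Iic R := hr.not_ge
    simp only [indicator_of_notMem hr', and_self]
  eos_rad r hr := by
    rw [indicator_of_mem (mem_Iic.2 hr.2), delta_curveDensity hK hr.2,
      hu.eta_curveDensity hK hR.2 hr, inLV, inXY]
  eos_tan r hr := by
    rw [indicator_of_mem (mem_Iic.2 hr.2), delta_curveDensity hK hr.2,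
      hu.eta_curveDensity hK hR.2 hr, inLV, inXY]

theorem exists_ball (law : HyperbolicLaw hrad htan κ a b Γ Υ Xflat Xsharp) (hK : 0 < K)
    (hl₀ : 0 < l₀) (hX : (Real.exp l₀ : EReal) < min Xflat Xsharp) :
    ∃ (R : ℝ) (ρ prad ptan : ℝ → ℝ), IsRegularElasticBall hrad htan K R ρ prad ptan ∧
      ρ 0 = K * Real.exp l₀ ^ 3 ∧ ∀ r ∈ Ioc 0 R, ballCurve K ρ r ∈ Ioo 0 l₀ ×ˢ Ioo (0 : ℝ) 1 := by
  obtain ⟨e, u, hu⟩ := law.exists_isStructureCurve hK hl₀ (lt_min_iff.1 hX).1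
  have he := hu.radius_pos
  have hcont : ContinuousOn (fun r => inLV (inXY hrad) (u r)) (Icc 0 e) :=
    law.rad_C1.continuousOn.comp
      (hu.continuousOn.fst.rexp.prodMk (continuousOn_const.sub hu.continuousOn.snd))
      fun r hr => ⟨Real.exp_pos _, sub_pos.2 (hu.snd_lt_one hr)⟩
  have hcenter : 0 < inLV (inXY hrad) (u 0) := by
    simpa only [hu.center, inLV, sub_zero] using
      law.signs.center_pos _ (Real.one_lt_exp_iff.2 hl₀) hX
  have hend : inLV (inXY hrad) (u e) < 0 := by
    have hv := hu.snd_mem e (right_mem_Ioc.2 he)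
    simpa only [inLV, hu.fst_eq_zero, Real.exp_zero] using
      law.signs.neg_at_one _ (sub_pos.2 hv.2) (sub_lt_self 1 hv.1)
  obtain ⟨R, hR, hzero, hpos⟩ := exists_first_zero he.le hcont hcenter hend.le
  have hRe : R < e := hR.2.lt_of_ne fun h => hend.ne (h ▸ hzero)
  refine ⟨R, _, _, _, law.isRegularElasticBall hK hu hX ⟨hR.1, hRe⟩ hpos hzero, ?_,
    fun r hr => ?_⟩
  · rw [indicator_of_mem (mem_Iic.2 hR.1.le), curveDensity, hu.center, sub_zero, mul_one]
  · have hr' : r ∈ Ioc 0 e := ⟨hr.1, hr.2.trans hRe.le⟩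
    rw [hu.eqOn_ballCurve hK hRe hr]
    exact ⟨⟨hu.fst_pos r ⟨hr.1.le, hr.2.trans_lt hRe⟩, hu.fst_lt hr'⟩, hu.snd_mem r hr'⟩

end HyperbolicLaw

end Existence

section Thresholds

variable {hrad htan : ℝ → ℝ → ℝ} {X D D' : EReal}

theorem exists_exp_pow_three_eq {d : ℝ} (hd : 0 < d) : ∃ l : ℝ, Real.exp l ^ 3 = d :=
  ⟨Real.log d / 3, by
    rw [← Real.exp_nat_mul, Nat.cast_ofNat, mul_div_cancel₀ _ three_ne_zero, Real.exp_log hd]⟩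

theorem coe_cube_lt_cube_iff (hX : 1 < X) {x : ℝ} :
    ((x ^ 3 : ℝ) : EReal) < X ^ 3 ↔ (x : EReal) < X := by
  induction X with
  | bot => exact absurd hX not_lt_bot
  | coe X =>
    rw [← EReal.coe_pow, EReal.coe_lt_coe_iff, EReal.coe_lt_coe_iff]
    exact (Odd.strictMono_pow (by decide)).lt_iff_lt
  | top =>
    rw [show (⊤ : EReal) ^ 3 = ⊤ by simp [pow_succ]]
    exact iff_of_true (EReal.coe_lt_top _) (EReal.coe_lt_top _)

theorem exists_of_cube_eq_coe (hX : 1 < X) {d : ℝ} (h : X ^ 3 = (d : EReal)) :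
    ∃ x : ℝ, X = (x : EReal) ∧ 0 < x ∧ x ^ 3 = d := by
  induction X with
  | bot => exact absurd hX not_lt_bot
  | coe X =>
    have hX1 : 1 < X := by exact_mod_cast hX
    exact ⟨X, rfl, one_pos.trans hX1, by exact_mod_cast h⟩
  | top => simp [pow_succ] at h

theorem one_lt_cube (hX : 1 < X) : 1 < X ^ 3 := by
  simpa using (coe_cube_lt_cube_iff hX (x := 1)).2 hX

theorem IsDeltaFlat.le (h : IsDeltaFlat hrad D) (h' : IsDeltaFlat hrad D') : D ≤ D' := by
  by_contra! hlt
  have h1 := h'.one_lt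
  lift D' to ℝ using ⟨hlt.ne_top, (bot_lt_of_lt h1).ne'⟩ with d
  have hd : 1 < d := by exact_mod_cast h1
  exact (h.pos d (one_pos.trans hd) hlt).ne' (h'.zero d rfl)

theorem IsDeltaSharp.isGreatest (h : IsDeltaSharp hrad htan D)
    (hz : ∀ d : ℝ, D = (d : EReal) → ∃ δ ∈ Ioo (0 : ℝ) d, hrad δ d = 0) :
    IsGreatest {D' : EReal | TanPositiveBelow hrad htan D'} D := by
  refine ⟨h.pos, fun D' hD' => ?_⟩
  by_contra! hlt
  have h1 := h.one_lt
  lift D to ℝ using ⟨hlt.ne_top, (bot_lt_of_lt h1).ne'⟩ with d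
  have hd : 1 < d := by exact_mod_cast h1
  obtain ⟨δ, hδ, hprad, hptan⟩ := h.boundary d rfl (hz d rfl)
  exact (hD' δ d (one_pos.trans hd) hlt hδ.1 hδ.2 hprad.ge).ne' hptan

theorem TangentialPositivity.isDeltaSharp
    (h : TangentialPositivity (inXY hrad) (inXY htan) X) : IsDeltaSharp hrad htan (X ^ 3) := by
  refine ⟨one_lt_cube h.one_lt, fun δ η hη hlt hδ hδη hp => ?_, fun d hd => ?_⟩
  · obtain ⟨l, rfl⟩ := exists_exp_pow_three_eq hη
    have := h.ptan_pos (Real.exp l) (δ / Real.exp l ^ 3) (Real.exp_pos l)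
      ((coe_cube_lt_cube_iff h.one_lt).1 hlt) (by positivity) ((div_lt_one hη).2 hδη)
    simp only [inXY, mul_div_cancel₀ _ hη.ne'] at this
    exact this hp
  · obtain ⟨x, hX, hx, rfl⟩ := exists_of_cube_eq_coe h.one_lt hd
    have hx3 : 0 < x ^ 3 := by positivity
    rintro ⟨δ, hδ, h0⟩
    obtain ⟨y, hy, hprad, hptan⟩ := h.boundary x hX
      ⟨δ / x ^ 3, ⟨div_pos hδ.1 hx3, (div_lt_one hx3).2 hδ.2⟩, by
        simpa only [inXY, mul_div_cancel₀ _ hx3.ne'] using h0⟩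
    exact ⟨x ^ 3 * y, ⟨mul_pos hx3 hy.1, mul_lt_of_lt_one_right hx3 hy.2⟩, hprad, hptan⟩

end Thresholds

section Bounds

variable {K l₀ r : ℝ} {ρ : ℝ → ℝ}

theorem rho_lt_of_ballCurve_mem (hK : 0 < K) (hη : 0 < centralEta K ρ r)
    (hmem : ballCurve K ρ r ∈ Iio l₀ ×ˢ Ioi (0 : ℝ)) : ρ r < K * Real.exp l₀ ^ 3 := by
  have hx : centralEta K ρ r < Real.exp l₀ ^ 3 := by
    rw [← exp_ballCurve_fst_pow hη]
    gcongr
    exact hmem.1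
  have hδ : delta K ρ r < Real.exp l₀ ^ 3 := by
    rw [← centralEta_mul_one_sub hη]
    exact (mul_lt_of_lt_one_right hη (sub_lt_self 1 hmem.2)).trans hx
  exact (div_lt_iff₀' hK).1 hδ

theorem max_mul_lt_mass_of_ballCurve_mem (hK : 0 < K) (hr : 0 < r) (hη : 0 < centralEta K ρ r)
    (hmem : ballCurve K ρ r ∈ Ioi (0 : ℝ) ×ˢ Ioi (0 : ℝ)) :
    4 * Real.pi / 3 * max (ρ r) K * r ^ 3 < mass ρ r := by
  have hone : 1 < centralEta K ρ r := by
    rw [← exp_ballCurve_fst_pow hη]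
    exact one_lt_pow₀ (Real.one_lt_exp_iff.2 hmem.1) three_ne_zero
  have hδ : delta K ρ r < centralEta K ρ r := by
    rw [← centralEta_mul_one_sub hη]
    exact mul_lt_of_lt_one_right hη (sub_lt_self 1 hmem.2)
  have := Real.pi_pos
  rw [mass_eq_eta hK hr, ← centralEta_of_pos hr]
  gcongr
  exact max_lt ((div_lt_iff₀' hK).1 hδ) (lt_mul_of_one_lt_right hK hone)

theorem mass_lt_of_ballCurve_mem (hK : 0 < K) (hr : 0 < r) (hη : 0 < centralEta K ρ r)
    (hlt : (ballCurve K ρ r).1 < l₀) :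
    mass ρ r < 4 * Real.pi / 3 * (K * Real.exp l₀ ^ 3) * r ^ 3 := by
  have := Real.pi_pos
  rw [mass_eq_eta hK hr, ← centralEta_of_pos hr, ← exp_ballCurve_fst_pow hη]
  gcongr

end Bounds

namespace HyperbolicLaw

variable {hrad htan : ℝ → ℝ → ℝ} {κ a b K l₀ x y : ℝ} {Γ Υ : ℝ → ℝ → ℝ} {Xflat Xsharp : EReal}

theorem gamma_eq_mul (law : HyperbolicLaw hrad htan κ a b Γ Υ Xflat Xsharp)
    (hx : 0 < x) (hy : 0 < y) : ∃ A > 0, Γ x y = A * d1 hrad (x ^ 3 * y) (x ^ 3) := by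
  have hκ := law.factor_pos
  refine ⟨κ⁻¹ * x ^ a * y ^ b * x ^ 3, by positivity, ?_⟩
  rw [law.gamma_eq x y hx hy, d2_inXY]
  ring

theorem d1_prad_pos (law : HyperbolicLaw hrad htan κ a b Γ Υ Xflat Xsharp)
    (hx : 0 < x) (hy : 0 < y) (h : 0 < Γ x y) : 0 < d1 hrad (x ^ 3 * y) (x ^ 3) := by
  obtain ⟨A, hA, hΓ⟩ := law.gamma_eq_mul hx hy
  exact (mul_pos_iff_of_pos_left hA).1 (hΓ ▸ h)

theorem isDeltaFlat (law : HyperbolicLaw hrad htan κ a b Γ Υ Xflat Xsharp) :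
    IsDeltaFlat hrad (Xflat ^ 3) := by
  have h1 := law.central.one_lt
  refine ⟨one_lt_cube h1, fun δ hδ hlt => ?_, fun δ hδ => ?_⟩
  · obtain ⟨l, rfl⟩ := exists_exp_pow_three_eq hδ
    have hl := Real.exp_pos l
    simpa only [mul_one] using law.d1_prad_pos hl one_pos
      (law.central.gamma_pos _ hl ((coe_cube_lt_cube_iff h1).1 hlt))
  · obtain ⟨x, hX, hx, rfl⟩ := exists_of_cube_eq_coe h1 hδ
    obtain ⟨A, hA, hΓ⟩ := law.gamma_eq_mul hx one_pos
    rw [law.central.gamma_flat x hX, mul_one] at hΓ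
    exact (mul_eq_zero.1 hΓ.symm).resolve_left hA.ne'

theorem exists_unique_ball (law : HyperbolicLaw hrad htan κ a b Γ Υ Xflat Xsharp) (hK : 0 < K)
    (hl₀ : 0 < l₀) (hX : (Real.exp l₀ : EReal) < min Xflat Xsharp) :
    ∃ (R : ℝ) (ρ prad ptan : ℝ → ℝ), IsRegularElasticBall hrad htan K R ρ prad ptan ∧
      ρ 0 = K * Real.exp l₀ ^ 3 ∧
      (∀ (R' : ℝ) (ρ' prad' ptan' : ℝ → ℝ),
        IsRegularElasticBall hrad htan K R' ρ' prad' ptan' → ρ' 0 = K * Real.exp l₀ ^ 3 →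
        R' = R ∧ ∀ r : ℝ, 0 ≤ r → ρ' r = ρ r ∧ prad' r = prad r ∧ ptan' r = ptan r) ∧
      ∀ r ∈ Ioc 0 R, 0 < d1 hrad (delta K ρ r) (eta K ρ r) ∧ ρ r < K * Real.exp l₀ ^ 3 ∧
        4 * Real.pi / 3 * max (ρ r) K * r ^ 3 < mass ρ r ∧
        mass ρ r < 4 * Real.pi / 3 * (K * Real.exp l₀ ^ 3) * r ^ 3 := by
  have hXflat := (lt_min_iff.1 hX).1
  obtain ⟨R, ρ, prad, ptan, ball, hρ0, hmem⟩ := law.exists_ball hK hl₀ hX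
  have hreg : ∀ r ∈ Ioc 0 R, ballCurve K ρ r ∈ regularDomain Γ := fun r hr =>
    law.mem_regularDomain hXflat ⟨(hmem r hr).1.2, (hmem r hr).2⟩
  refine ⟨R, ρ, prad, ptan, ball, hρ0, fun R' ρ' prad' ptan' ball' h0' => ?_, fun r hr => ?_⟩
  · obtain ⟨rfl, hρ, hprad, hptan⟩ := law.ball_unique hK hXflat ball hρ0
      (fun r hr => hreg r (Ioo_subset_Ioc_self hr)) ball' h0'
    exact ⟨rfl, fun r hr => ⟨(hρ hr).symm, (hprad hr).symm, (hptan hr).symm⟩⟩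
  · have hη := centralEta_of_pos (K := K) (ρ := ρ) hr.1 ▸ ball.eta_pos hK hr
    obtain ⟨hl, hv⟩ := hmem r hr
    have hd1 := law.d1_prad_pos (Real.exp_pos _) (sub_pos.2 hv.2) (hreg r hr).2
    rw [exp_ballCurve_fst_pow hη, centralEta_mul_one_sub hη, centralEta_of_pos hr.1] at hd1
    exact ⟨hd1, rho_lt_of_ballCurve_mem hK hη ⟨hl.2, hv.1⟩,
      max_mul_lt_mass_of_ballCurve_mem hK hr.1 hη ⟨hl.1, hv.1⟩,
      mass_lt_of_ballCurve_mem hK hr.1 hη hl.2⟩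

end HyperbolicLaw

end ElasticBall

end

theorem theorem2_general (hrad htan : ℝ → ℝ → ℝ) (κ a b : ℝ) (Γ Υ : ℝ → ℝ → ℝ)
    (Xflat Xsharp : EReal)
    (law : ElasticBall.HyperbolicLaw hrad htan κ a b Γ Υ Xflat Xsharp) :
    ∃ Dflat Dsharp D : EReal,
      Dflat = Xflat ^ 3 ∧ Dsharp = Xsharp ^ 3 ∧ D = min Dflat Dsharp ∧ 1 < D ∧
      ElasticBall.IsDeltaFlat hrad Dflat ∧
      (∀ D' : EReal, ElasticBall.IsDeltaFlat hrad D' → D' = Dflat) ∧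
      ElasticBall.IsDeltaSharp hrad htan Dsharp ∧
      ((∀ d : ℝ, Dsharp = (d : EReal) → ∃ δ ∈ Set.Ioo (0 : ℝ) d, hrad δ d = 0) →
        IsGreatest {D' : EReal | ElasticBall.TanPositiveBelow hrad htan D'} Dsharp) ∧
      ∀ ρc K : ℝ, 0 < ρc → 0 < K → 1 < ρc / K → ((ρc / K : ℝ) : EReal) < D →
        0 < hrad (ρc / K) (ρc / K) ∧
        0 < ElasticBall.d1 hrad (ρc / K) (ρc / K) ∧
        ∃ (R : ℝ) (ρ prad ptan : ℝ → ℝ),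
          ElasticBall.IsRegularElasticBall hrad htan K R ρ prad ptan ∧ ρ 0 = ρc ∧
          (∀ (R' : ℝ) (ρ' prad' ptan' : ℝ → ℝ),
            ElasticBall.IsRegularElasticBall hrad htan K R' ρ' prad' ptan' → ρ' 0 = ρc →
            R' = R ∧ ∀ r : ℝ, 0 ≤ r → ρ' r = ρ r ∧ prad' r = prad r ∧ ptan' r = ptan r) ∧
          ∀ r ∈ Set.Ioc 0 R,
            0 < ElasticBall.d1 hrad (ElasticBall.delta K ρ r) (ElasticBall.eta K ρ r) ∧
            ρ r < ρc ∧
            4 * Real.pi / 3 * max (ρ r) K * r ^ 3 < ElasticBall.mass ρ r ∧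
            ElasticBall.mass ρ r < 4 * Real.pi / 3 * ρc * r ^ 3 := by
  have hflat := law.central.one_lt
  have hsharp := law.tangential.one_lt
  have hDsharp := law.tangential.isDeltaSharp
  refine ⟨Xflat ^ 3, Xsharp ^ 3, _, rfl, rfl, rfl,
    lt_min (ElasticBall.one_lt_cube hflat) (ElasticBall.one_lt_cube hsharp), law.isDeltaFlat,
    fun D' hD' => le_antisymm (hD'.le law.isDeltaFlat) (law.isDeltaFlat.le hD'),
    hDsharp, hDsharp.isGreatest, fun ρc K hρc hK hδ hlt => ?_⟩
  obtain ⟨l₀, hl₀⟩ := ElasticBall.exists_exp_pow_three_eq (div_pos hρc hK)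
  obtain rfl : K * Real.exp l₀ ^ 3 = ρc := by rw [hl₀, mul_div_cancel₀ _ hK.ne']
  rw [← hl₀] at hlt hδ ⊢
  have hX : (Real.exp l₀ : EReal) < min Xflat Xsharp :=
    lt_min ((ElasticBall.coe_cube_lt_cube_iff hflat).1 (lt_min_iff.1 hlt).1)
      ((ElasticBall.coe_cube_lt_cube_iff hsharp).1 (lt_min_iff.1 hlt).2)
  have hx := Real.exp_pos l₀
  have hx1 : 1 < Real.exp l₀ := (one_lt_pow_iff_of_nonneg hx.le three_ne_zero).1 hδ
  have hprad := law.signs.center_pos _ hx1 hX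
  have hd1 := law.d1_prad_pos hx one_pos (law.central.gamma_pos _ hx (lt_min_iff.1 hX).1)
  rw [ElasticBall.inXY, mul_one] at hprad
  rw [mul_one] at hd1
  exact ⟨hprad, hd1, law.exists_unique_ball hK (Real.one_lt_exp_iff.1 hx1) hX⟩

theorem theorem2 (hrad htan : ℝ → ℝ → ℝ) (lam mu a b c : ℝ) (Γ Υ : ℝ → ℝ → ℝ)
    (Xflat Xsharp : EReal)
    (hyp : ElasticBall.ConstitutiveAssumptions hrad htan lam mu a b c Γ Υ Xflat Xsharp) :
    ∃ Dflat Dsharp D : EReal,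
      -- the threshold and how the constitutive functions determine it
      Dflat = Xflat ^ 3 ∧ Dsharp = Xsharp ^ 3 ∧ D = min Dflat Dsharp ∧ 1 < D ∧
      ElasticBall.IsDeltaFlat hrad Dflat ∧
      (∀ D' : EReal, ElasticBall.IsDeltaFlat hrad D' → D' = Dflat) ∧
      ElasticBall.IsDeltaSharp hrad htan Dsharp ∧
      ((∀ d : ℝ, Dsharp = (d : EReal) → ∃ δ ∈ Set.Ioo (0 : ℝ) d, hrad δ d = 0) →
        IsGreatest {D' : EReal | ElasticBall.TanPositiveBelow hrad htan D'} Dsharp) ∧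
      -- elastic balls with central density `ρc` and reference density `K`
      ∀ ρc K : ℝ, 0 < ρc → 0 < K → 1 < ρc / K → ((ρc / K : ℝ) : EReal) < D →
        0 < hrad (ρc / K) (ρc / K) ∧
        0 < ElasticBall.d1 hrad (ρc / K) (ρc / K) ∧
        ∃ (R : ℝ) (ρ prad ptan : ℝ → ℝ),
          ElasticBall.IsRegularElasticBall hrad htan K R ρ prad ptan ∧ ρ 0 = ρc ∧
          (∀ (R' : ℝ) (ρ' prad' ptan' : ℝ → ℝ),
            ElasticBall.IsRegularElasticBall hrad htan K R' ρ' prad' ptan' → ρ' 0 = ρc →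
            R' = R ∧ ∀ r : ℝ, 0 ≤ r → ρ' r = ρ r ∧ prad' r = prad r ∧ ptan' r = ptan r) ∧
          ∀ r ∈ Set.Ioc 0 R,
            0 < ElasticBall.d1 hrad (ElasticBall.delta K ρ r) (ElasticBall.eta K ρ r) ∧
            ρ r < ρc ∧
            4 * Real.pi / 3 * max (ρ r) K * r ^ 3 < ElasticBall.mass ρ r ∧
            ElasticBall.mass ρ r < 4 * Real.pi / 3 * ρc * r ^ 3 :=
  theorem2_general hrad htan (lam + 2 * mu) a b Γ Υ Xflat Xsharp hyp.hyperbolicLaw
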